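/- Fix integers $d\ge 1$, $s\ge 1$. **Model.** Let $M\subset\mathbb R^d$ be compact, let $\mu$ be a probability density (w.r.t. Lebesgue measure) of a law carried by $M$, and let $(x_i,y_i)_{i\le n}$ be i.i.d. with $x_i\sim\mu$, $y_i=f(x_i)+\epsilon_i$, where $\epsilon_i\sim\mathcal N(0,\sigma_\epsilon^2)$ is independent of $x_i$. Assume $|f|\le C_f$ on $M$, $0\le\sigma_\epsilon\le C_f$, $B_{r_0}(x_0)\subset M$ with $r_0>0$, and that $f$ and $\mu$ are $\mathcal C^s$ at $x_0$ with constants $L_f$ and $L_\mu$. Here $g$ is $\mathcal C^s$ at $x_0$ with constant $L$ if all partial derivatives of $g$ of order at most $s$ exist at $x_0$ and $$\Big|g(y)-g(x_0)-\sum_{j=1}^{s-1}\tfrac1{j!}\nabla^jg(x_0)[y-x_0,\dots,y-x_0]\Big|\le L\|y-x_0\|^s\qquad(\|y-x_0\|\le r_0).$$ **Kernel.** Let $K_\sigma(x,x')=\sigma^{-d}K(\|x-x'\|/\sigma)$, where $K:\mathbb R\to\mathbb R$ is even, $|K(u)|\le C_Ke^{-|u|^2/C_K}$, $\int_{\mathbb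 R^d}K(\|x\|)\,dx=1$, and $\int_{\mathbb R^d}x^aK(\|x\|)\,dx=0$ for all multi-indices $a$ with $1\le|a|\le s-1$ (a regular radial basis kernel of order $s$). **Estimator.** Let $\epsilon,\delta>0$, $R_f\ge0$, $c_0>0$. Replace $x_i$ by a nearest point of $M$ and $y_i$ by its projection $\Pi_{R_f}(y_i)$ onto $[-R_f,R_f]$. With the data so projected, put $d_\sigma=\sum_iK_\sigma(x_0,x_i)$ and $$\hat f=\Pi_{R_f}\Big(\tfrac1{d_\sigma}\sum_iK_\sigma(x_0,x_i)y_i\Big),\qquad \gamma=\frac{\big(d_\sigma-c_0n-2\sigma^{-d}C_K\big)_+}{2\sigma^{-d}C_K},\qquad \alpha=\frac{4R_fC_K}{\sigma^dc_0n}$$ (the quotient being read as $0$ if $d_\sigma=0$), and $$T=1+\frac2\epsilon\log\max\{1/\delta,1/\epsilon\},\qquad p=\frac{e^{\epsilon(\gamma-T)/2}}{e^{\epsilon(\gamma-T)/2}+1}.$$ Given the data, the ePTR Nadaraya–Watson estimator $\hat f_\gamma(x_0)$ equals $\hat f+\frac{2\alpha}\epsilon\sqrt{2\log(1.25/\delta)}\,\zeta$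 with $\zeta\sim\mathcal N(0,1)$ independent of everything else, with probability $p$; with probability $1-p$ it is an independent draw from a fixed law $\pi_\bot$ on $\mathbb R$ with $|t-f(x_0)|^2\le C_\bot$ for $\pi_\bot$-a.e. $t$. **Claim.** Let $\sigma=n^{-1/(d+2s)}$, $n\ge2$, and suppose that $$C_f(1+4\sqrt{\log n})\le R_f\le C_R\sqrt{\log n},\quad \delta\le n^{-3},\quad \mu(x_0)>2c_0+\frac{4C_K}{n\sigma^d},\quad n\ge\frac{1+8\log(1/\delta)}{\mu(x_0)\epsilon}.$$ Then $$\mathbb E\big|\hat f_\gamma(x_0)-f(x_0)\big|^2=\widetilde O\big(n^{-2s/(2s+d)}+\epsilon^{-2}n^{-4s/(2s+d)}\big),$$ where $\widetilde O$ hides powers of $\log n$ and, in the privacy term, of $\log(1/\delta)$: there are constants $C$ and $k\in\mathbb N$, depending only on $d,s,C_f,L_f,L_\mu,r_0,C_K,c_0,C_R,C_\bot$, such that under all these assumptions $$\mathbb E\big|\hat f_\gamma(x_0)-f(x_0)\big|^2\le C\Big((\log n)^k\,n^{-\frac{2s}{2s+d}}+(\log\tfrac1\delta)^k\,\epsilon^{-2}\,n^{-\frac{4s}{2s+d}}\Big).$$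 -/

import Mathlib

open MeasureTheory ProbabilityTheory Topology

namespace EPTR

noncomputable section

/-- The ambient space `ℝ^d` with its Euclidean norm. -/
abbrev Space (d : ℕ) : Type := EuclideanSpace ℝ (Fin d)

/-- The iterated partial derivative `∂_{i₁} ∂_{i₂} ⋯ ∂_{i_m} g` for the list `[i₁, …, i_m]`. -/
def iterPartial {d : ℕ} (g : Space d → ℝ) : List (Fin d) → Space d → ℝ
  | [] => g
  | i :: l => fun x => lineDeriv ℝ (iterPartial g l) x (EuclideanSpace.single i (1 : ℝ))

/-- The iterated partial derivative `∂_{i₁} ⋯ ∂_{i_m} g` exists at `x`: the inner derivative exists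
near `x` on the line through `x` in direction `e_{i₁}`, and is differentiable along it at `x`. -/
def HasIterPartialAt {d : ℕ} (g : Space d → ℝ) : List (Fin d) → Space d → Prop
  | [], _ => True
  | i :: l, x =>
      (∀ᶠ t in 𝓝 (0 : ℝ), HasIterPartialAt g l (x + t • EuclideanSpace.single i (1 : ℝ))) ∧
        LineDifferentiableAt ℝ (iterPartial g l) x (EuclideanSpace.single i (1 : ℝ))

/-- `∇^j g(x)[v, …, v]`. -/
def gradForm {d : ℕ} (g : Space d → ℝ) (j : ℕ) (x v : Space d) : ℝ :=
  ∑ i : Fin j → Fin d, iterPartial g (List.ofFn i) x * ∏ k, v (i k)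

/-- `g` is `𝒞^s` at `x` with radius `r₀` and constant `L`: all partial derivatives of order at most
`s` exist at `x`, and the Taylor polynomial of degree `s - 1` at `x` approximates `g` up to
`L ‖y - x‖ ^ s` on the ball of radius `r₀`. -/
structure SmoothAt {d : ℕ} (s : ℕ) (L r₀ : ℝ) (g : Space d → ℝ) (x : Space d) : Prop where
  partials : ∀ l : List (Fin d), l.length ≤ s → HasIterPartialAt g l x
  taylor : ∀ y : Space d, ‖y - x‖ ≤ r₀ →
    |g y - g x - ∑ j ∈ Finset.Icc 1 (s - 1), 1 / (j.factorial : ℝ) * gradForm g j x (y - x)|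
      ≤ L * ‖y - x‖ ^ s

/-- `K` is the profile of a regular radial basis kernel of order `s` on `ℝ^d` with constant `C_K`:
an even function of Gaussian decay such that `x ↦ K ‖x‖` has integral one and vanishing moments
`∫ x^a K ‖x‖ dx` for all multi-indices `a` with `1 ≤ |a| ≤ s - 1`. -/
structure IsRegularKernel (d s : ℕ) (CK : ℝ) (K : ℝ → ℝ) : Prop where
  measurable : Measurable K
  even : ∀ u, K (-u) = K u
  integral_one : ∫ x : Space d, K ‖x‖ = 1
  moments : ∀ a : Fin d → ℕ, 1 ≤ ∑ i, a i → ∑ i, a i ≤ s - 1 →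
    ∫ x : Space d, (∏ i, x i ^ a i) * K ‖x‖ = 0
  decay : ∀ u, |K u| ≤ CK * Real.exp (-|u| ^ 2 / CK)

/-- `K_σ(x, x') = σ^{-d} K(‖x - x'‖ / σ)`. -/
def scaledKernel {d : ℕ} (K : ℝ → ℝ) (σ : ℝ) (x x' : Space d) : ℝ :=
  1 / σ ^ d * K (‖x - x'‖ / σ)

/-- The law on `ℝ^d` with density `μ` with respect to Lebesgue measure. -/
def designLaw {d : ℕ} (μ : Space d → ℝ) : Measure (Space d) :=
  volume.withDensity fun x => ENNReal.ofReal (μ x)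

/-- The law of one observation `(x, f x + e)`, where `x` has density `μ` and `e` is an independent
centred Gaussian with standard deviation `σe`. -/
def obsLaw {d : ℕ} (μ f : Space d → ℝ) (σe : ℝ) : Measure (Space d × ℝ) :=
  ((designLaw μ).prod (gaussianReal 0 (σe ^ 2).toNNReal)).map fun p => (p.1, f p.1 + p.2)

/-- The law of `n` independent observations. -/
def sampleLaw {d : ℕ} (n : ℕ) (μ f : Space d → ℝ) (σe : ℝ) :
    Measure (Fin n → Space d × ℝ) :=
  Measure.pi fun _ => obsLaw μ f σe

/-- The data generating process of the regression problem: compact domain `M`, design density `μ`,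
regression function `f`, noise level `σe`, query point `x₀`. -/
structure IsRegressionModel {d : ℕ} (s : ℕ) (Cf Lf Lμ r₀ : ℝ) (M : Set (Space d))
    (μ f : Space d → ℝ) (σe : ℝ) (x₀ : Space d) : Prop where
  compact : IsCompact M
  density_measurable : Measurable μ
  density_nonneg : ∀ x, 0 ≤ μ x
  design_prob : IsProbabilityMeasure (designLaw μ)
  design_support : designLaw μ Mᶜ = 0
  f_measurable : Measurable f
  f_bound : ∀ x ∈ M, |f x| ≤ Cf
  noise_nonneg : 0 ≤ σe
  noise_bound : σe ≤ Cf
  interior : Metric.ball x₀ r₀ ⊆ M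
  f_smooth : SmoothAt s Lf r₀ f x₀
  density_smooth : SmoothAt s Lμ r₀ μ x₀

/-- `proj` is a nearest-point projection onto `M`. -/
def IsProjection {d : ℕ} (M : Set (Space d)) (proj : Space d → Space d) : Prop :=
  ∀ x, proj x ∈ M ∧ dist x (proj x) = Metric.infDist x M

/-- The projection of a real number onto `[-R, R]`. -/
def clip (R y : ℝ) : ℝ := max (-R) (min R y)

/-- The degree function `d_σ(x₀, 𝒳) = ∑ i, K_σ(x₀, x_i)`. -/
def degree {d n : ℕ} (K : ℝ → ℝ) (σ : ℝ) (x₀ : Space d) (z : Fin n → Space d × ℝ) : ℝ :=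
  ∑ i, scaledKernel K σ x₀ (z i).1

/-- The Nadaraya-Watson estimator, projected onto `[-R, R]`. -/
def nwEstimator {d n : ℕ} (K : ℝ → ℝ) (σ R : ℝ) (x₀ : Space d) (z : Fin n → Space d × ℝ) : ℝ :=
  clip R ((∑ i, scaledKernel K σ x₀ (z i).1 * (z i).2) / degree K σ x₀ z)

/-- The sub-distance `γ` of the Nadaraya-Watson ePTR procedure. -/
def nwGamma {d n : ℕ} (K : ℝ → ℝ) (CK σ c₀ : ℝ) (x₀ : Space d) (z : Fin n → Space d × ℝ) : ℝ :=
  1 / (2 * (1 / σ ^ d) * CK) * max 0 (degree K σ x₀ z - c₀ * n - 2 * (1 / σ ^ d) * CK)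

/-- The threshold `M` of efficient propose-test-release. -/
def threshold (ε δ : ℝ) : ℝ := 1 + 2 / ε * Real.log (max (1 / δ) (1 / ε))

/-- The release probability of efficient propose-test-release. -/
def releaseProb (ε δ γ : ℝ) : ℝ :=
  Real.exp (1 / 2 * ε * (γ - threshold ε δ)) / (Real.exp (1 / 2 * ε * (γ - threshold ε δ)) + 1)

/-- The output law of efficient propose-test-release on a data set with (real) estimate `est` and
sub-distance value `γ`, at sensitivity level `α`: with probability `1 - p` the output is a draw
from the null-response law `bot`, with probability `p` it is the estimate plus Gaussian noise. -/
def eptrLaw (ε δ α : ℝ) (bot : Measure ℝ) (est γ : ℝ) : Measure ℝ :=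
  ENNReal.ofReal (1 - releaseProb ε δ γ) • bot +
    ENNReal.ofReal (releaseProb ε δ γ) •
      (gaussianReal 0 1).map
        (fun ζ => est + 2 * α / ε * Real.sqrt (2 * Real.log (1.25 / δ)) * ζ)

/-- Nadaraya-Watson regression with ePTR: project the data, then run ePTR on the projected
Nadaraya-Watson estimator with its `γ` and `α = 4 R C_K / (σ^d c₀ n)`. The value is the law of the
output given the data `z`. -/
def nwEptr {d n : ℕ} (proj : Space d → Space d) (K : ℝ → ℝ) (CK σ c₀ R ε δ : ℝ)
    (bot : Measure ℝ) (x₀ : Space d) (z : Fin n → Space d × ℝ) : Measure ℝ :=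
  let z' : Fin n → Space d × ℝ := fun i => (proj (z i).1, clip R (z i).2)
  eptrLaw ε δ (4 * R * CK / (σ ^ d * c₀ * n)) bot (nwEstimator K σ R x₀ z')
    (nwGamma K CK σ c₀ x₀ z')

/-- The mean square error `E (θ̃ - θ)²` of a randomized estimator: the data follow `P` and, given
the data `z`, the output follows `mech z`. -/
def risk {Z : Type*} [MeasurableSpace Z] (P : Measure Z) (mech : Z → Measure ℝ) (θ : ℝ) :
    ENNReal :=
  ∫⁻ z, ∫⁻ t, ENNReal.ofReal ((t - θ) ^ 2) ∂(mech z) ∂P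

end

end EPTR

/-! Put `S = n σ^d = n^{2s/(2s+d)}`. The bandwidth balances the variance `1/S` against the squared
bias `σ^{2s}`, and the two rates of the theorem are `1/S` and `(1/S)^2`.

Given the data, the loss is at most the sum of three terms (`lintegral_eptrLaw_le`): the probability
of a null response times `Cbot`, the squared error of the clipped estimator, and the variance of the
privacy noise. The last is of order `R^2 log(1/δ) / (ε S)^2`, which is the privacy term because `R^2
= O(log n)` (`noise_le`).

If `S` is bounded, or `ε S` is at most a multiple of `log(1/δ)`, the trivial loss bound `Cbot + 4
R^2` is already within the claimed rate. Otherwise `loss_le` splits on the degree. Where the degree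
is at least `3/4` of `n μ(x₀)`, the null response has probability at most `δ` and the error is at
most the centred numerator divided by `c₀ n`. Elsewhere the trivial loss is paid for by the squared
deviation of the degree, a pointwise Chebyshev inequality. No concentration beyond second moments is
needed: it suffices to bound the mean squares of the degree deviation and of the centred numerator
(`exists_degree_moment`, `exists_numerator_moment`). Each is a variance of order `n σ^{-d}`, with an
extra `R^2` for the numerator, plus a squared mean of order `(n σ^s)^2`.

The means are kernel biases: Taylor expansion, vanishing moments and Gaussian decay leave `O(σ^s)`
(`exists_kernel_bias`, `exists_kernel_tail`), and clipping the responses adds `O(1/n)` by a Chernoff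
bound. The delicate point is uniformity. The hypotheses bound the Taylor remainder but no derivative
of `μ` or `f`. The remainder and the `L¹` norm of the function together bound the `L¹` norm of the
Taylor polynomial, and finite dimensionality turns this into a bound on coefficients
(`exists_coeff_bound`, `exists_jet`). -/

namespace EPTR

/-! ### Polynomials on `ℝ^d` and control of their coefficients -/

/-- The monomial `v ^ a` on `ℝ^d`. -/
def mono {d : ℕ} (a : Fin d → ℕ) (v : Space d) : ℝ := ∏ l, v l ^ a l

/-- The polynomial `∑ i, c i * v ^ (a i)` on `ℝ^d`. -/
def poly {d : ℕ} {ι : Type*} [Fintype ι] (a : ι → Fin d → ℕ) (c : ι → ℝ) (v : Space d) : ℝ :=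
  ∑ i, c i * mono (a i) v

lemma abs_mono_le {d : ℕ} (a : Fin d → ℕ) (v : Space d) : |mono a v| ≤ ‖v‖ ^ ∑ l, a l := by
  rw [mono, Finset.abs_prod, ← Finset.prod_pow_eq_pow_sum]
  refine Finset.prod_le_prod (fun _ _ => abs_nonneg _) fun l _ => ?_
  rw [abs_pow]
  exact pow_le_pow_left₀ (abs_nonneg _) (by simpa using PiLp.norm_apply_le v l) _

lemma continuous_mono {d : ℕ} (a : Fin d → ℕ) : Continuous (mono a) := by
  unfold mono; fun_prop

lemma continuous_poly {d : ℕ} {ι : Type*} [Fintype ι] (a : ι → Fin d → ℕ) (c : ι → ℝ) :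
    Continuous (poly a c) :=
  continuous_finsetSum _ fun i _ => continuous_const.mul (continuous_mono (a i))

lemma mono_smul {d : ℕ} (a : Fin d → ℕ) (t : ℝ) (v : Space d) :
    mono a (t • v) = t ^ (∑ l, a l) * mono a v := by
  simp [mono, mul_pow, Finset.prod_mul_distrib, Finset.prod_pow_eq_pow_sum]

lemma mono_add {d : ℕ} (a b : Fin d → ℕ) (v : Space d) :
    mono (a + b) v = mono a v * mono b v := by
  simp [mono, pow_add, Finset.prod_mul_distrib]

lemma mono_zero_apply {d : ℕ} (a : Fin d → ℕ) (h : 1 ≤ ∑ l, a l) : mono a (0 : Space d) = 0 := by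
  obtain ⟨l, -, hl⟩ : ∃ l ∈ Finset.univ, a l ≠ 0 := by
    by_contra! hc
    rw [Finset.sum_eq_zero hc] at h
    omega
  exact Finset.prod_eq_zero (Finset.mem_univ l) (by simp [hl])

lemma mono_eq_one {d : ℕ} (a : Fin d → ℕ) (h : ∑ l, a l = 0) (v : Space d) : mono a v = 1 := by
  have h' : ∀ l, a l = 0 := by simpa using h
  simp [mono, h']

lemma poly_mul {d : ℕ} {ι κ : Type*} [Fintype ι] [Fintype κ] (a : ι → Fin d → ℕ)
    (b : κ → Fin d → ℕ) (c : ι → ℝ) (e : κ → ℝ) (v : Space d) :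
    poly a c v * poly b e v =
      poly (fun p : ι × κ => a p.1 + b p.2) (fun p => c p.1 * e p.2) v := by
  simp only [poly, Fintype.sum_prod_type, Finset.sum_mul_sum, mono_add]
  refine Finset.sum_congr rfl fun i _ => Finset.sum_congr rfl fun j _ => by ring

lemma abs_poly_le {d : ℕ} {ι : Type*} [Fintype ι] (a : ι → Fin d → ℕ) {c : ι → ℝ} {B : ℝ}
    (hc : ∀ i, |c i| ≤ B) (v : Space d) :
    |poly a c v| ≤ B * ∑ i, ‖v‖ ^ ∑ l, a i l := by
  rw [poly, Finset.mul_sum]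
  refine (Finset.abs_sum_le_sum_abs _ _).trans (Finset.sum_le_sum fun i _ => ?_)
  rw [abs_mul]
  exact mul_le_mul (hc i) (abs_mono_le _ _) (abs_nonneg _) ((abs_nonneg _).trans (hc i))

lemma abs_poly_le_of_mem_ball {d : ℕ} {ι : Type*} [Fintype ι] (a : ι → Fin d → ℕ) {c : ι → ℝ}
    {B r : ℝ} (hc : ∀ i, |c i| ≤ B) (hB : 0 ≤ B) {v : Space d} (hv : v ∈ Metric.ball 0 r) :
    |poly a c v| ≤ B * ∑ i, r ^ ∑ l, a i l := by
  rw [mem_ball_zero_iff] at hv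
  refine (abs_poly_le a hc v).trans (mul_le_mul_of_nonneg_left ?_ hB)
  exact Finset.sum_le_sum fun i _ => pow_le_pow_left₀ (norm_nonneg _) hv.le _

lemma integrableOn_poly_ball {d : ℕ} {ι : Type*} [Fintype ι] (a : ι → Fin d → ℕ) (c : ι → ℝ)
    (r : ℝ) : IntegrableOn (poly a c) (Metric.ball (0 : Space d) r) :=
  ((continuous_poly a c).continuousOn.integrableOn_compact
    (isCompact_closedBall 0 r)).mono_set Metric.ball_subset_closedBall

/-- A polynomial agrees on a ball with one whose coefficients are controlled by its `L¹` norm. -/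
lemma exists_coeff_bound {d : ℕ} {ι : Type*} [Fintype ι] (a : ι → Fin d → ℕ) (r : ℝ) :
    ∃ C : ℝ, 0 ≤ C ∧ ∀ c : ι → ℝ, ∃ c' : ι → ℝ,
      (∀ v ∈ Metric.ball (0 : Space d) r, poly a c' v = poly a c v) ∧
      ∀ i, |c' i| ≤ C * ∫ v in Metric.ball (0 : Space d) r, |poly a c v| := by
  classical
  let ν : Measure (Space d) := volume.restrict (Metric.ball 0 r)
  have hi : ∀ c : ι → ℝ, Integrable (poly a c) ν := fun c => integrableOn_poly_ball a c r
  let A : (ι → ℝ) →ₗ[ℝ] (Lp ℝ 1 ν) :=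
    { toFun := fun c => (hi c).toL1 _
      map_add' := fun c e => by
        rw [← Integrable.toL1_add]
        refine (Integrable.toL1_eq_toL1_iff _ _ _ _).2 (Filter.Eventually.of_forall fun v => ?_)
        simp [poly, add_mul, Finset.sum_add_distrib]
      map_smul' := fun t c => by
        rw [RingHom.id_apply, ← Integrable.toL1_smul]
        refine (Integrable.toL1_eq_toL1_iff _ _ _ _).2 (Filter.Eventually.of_forall fun v => ?_)
        simp [poly, Finset.mul_sum, mul_assoc] }
  -- `A` need not be injective, since several indices may carry the same monomial; hence a right
  -- inverse on the range. The range is finite-dimensional, so this inverse is continuous and its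
  -- norm is the constant.
  obtain ⟨g, hg⟩ := A.rangeRestrict.exists_rightInverse_of_surjective A.range_rangeRestrict
  let G := LinearMap.toContinuousLinearMap g
  refine ⟨‖G‖, G.opNorm_nonneg, fun c => ⟨g (A.rangeRestrict c), ?_, fun i => ?_⟩⟩
  · have h1 : A (g (A.rangeRestrict c)) = A c :=
      congrArg Subtype.val (LinearMap.congr_fun hg (A.rangeRestrict c))
    have h2 := (Integrable.toL1_eq_toL1_iff _ _ (hi _) (hi _)).1 h1
    exact Measure.eqOn_open_of_ae_eq h2 Metric.isOpen_ball (continuous_poly _ _).continuousOn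
      (continuous_poly _ _).continuousOn
  · have h1 : ‖A c‖ = ∫ v in Metric.ball (0 : Space d) r, |poly a c v| :=
      L1.norm_of_fun_eq_integral_norm (hi c)
    have h2 := G.le_opNorm (A.rangeRestrict c)
    rw [← h1]
    exact (norm_le_pi_norm (g (A.rangeRestrict c)) i).trans h2

/-! ### Taylor jets with uniformly bounded coefficients -/

/-- The words of length less than `s` in the letters `1, …, d`. -/
abbrev Word (d s : ℕ) : Type := (j : Fin s) × (Fin j → Fin d)

/-- The number of occurrences of each letter in a word. -/
def wordExp {d s : ℕ} (w : Word d s) (l : Fin d) : ℕ := (Finset.univ.filter fun k => w.2 k = l).card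

lemma mono_wordExp {d s : ℕ} (w : Word d s) (v : Space d) :
    mono (wordExp w) v = ∏ k, v (w.2 k) := by
  rw [mono, ← Finset.prod_fiberwise Finset.univ w.2]
  refine Finset.prod_congr rfl fun l _ => ?_
  rw [Finset.prod_congr rfl (g := fun _ => v l) (by simp +contextual), Finset.prod_const, wordExp]

/-- The Taylor coefficients of `g` at `x`, indexed by words. -/
noncomputable def taylorCoeff {d : ℕ} (s : ℕ) (g : Space d → ℝ) (x : Space d) (w : Word d s) : ℝ :=
  1 / ((w.1 : ℕ).factorial : ℝ) * iterPartial g (List.ofFn w.2) x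

/-- Indexing by words instead of multi-indices matches `gradForm` directly: partial derivatives are
not assumed to commute, so words with equal letter counts cannot be merged. The empty word supplies
the constant term. -/
lemma poly_taylorCoeff {d s : ℕ} (hs : 1 ≤ s) (g : Space d → ℝ) (x v : Space d) :
    poly wordExp (taylorCoeff s g x) v =
      g x + ∑ j ∈ Finset.Icc 1 (s - 1), 1 / (j.factorial : ℝ) * gradForm g j x v := by
  have h1 : poly wordExp (taylorCoeff s g x) v =
      ∑ j : Fin s, 1 / ((j : ℕ).factorial : ℝ) * gradForm g j x v := by
    rw [poly, Fintype.sum_sigma]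
    refine Finset.sum_congr rfl fun j _ => ?_
    rw [gradForm, Finset.mul_sum]
    refine Finset.sum_congr rfl fun i _ => ?_
    rw [mono_wordExp, taylorCoeff, mul_assoc]
  rw [h1, Fin.sum_univ_eq_sum_range (fun j => 1 / (j.factorial : ℝ) * gradForm g j x v) s,
    Finset.range_eq_Ico, Finset.sum_eq_sum_Ico_succ_bot (by omega)]
  congr 1
  simp [gradForm, iterPartial]

lemma SmoothAt.abs_sub_poly_le {d s : ℕ} (hs : 1 ≤ s) {L r₀ : ℝ} {g : Space d → ℝ} {x : Space d}
    (h : SmoothAt s L r₀ g x) {v : Space d} (hv : v ∈ Metric.ball 0 r₀) :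
    |g (x + v) - poly wordExp (taylorCoeff s g x) v| ≤ |L| * ‖v‖ ^ s := by
  have := h.taylor (x + v) (by simpa using (mem_ball_zero_iff.1 hv).le)
  rw [poly_taylorCoeff hs, ← sub_sub]
  simp only [add_sub_cancel_left] at this
  exact this.trans (mul_le_mul_of_nonneg_right (le_abs_self L) (by positivity))

lemma setIntegral_ball_add {d : ℕ} (F : Space d → ℝ) (x : Space d) (r : ℝ) :
    ∫ v in Metric.ball 0 r, F (x + v) = ∫ y in Metric.ball x r, F y := by
  have h := (measurePreserving_add_left (volume : Measure (Space d)) x).setIntegral_preimage_emb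
    (measurableEmbedding_addLeft x) F (Metric.ball x r)
  rw [← h]
  congr 2
  ext v
  simp

/-- A function that is smooth at `x` and has bounded `L¹` norm near `x` has a polynomial
approximation at `x` with bounded coefficients. -/
lemma exists_jet (d s : ℕ) (hs : 1 ≤ s) (L r₀ B : ℝ) :
    ∃ C : ℝ, 0 ≤ C ∧ ∀ (g : Space d → ℝ) (x : Space d), SmoothAt s L r₀ g x →
      IntegrableOn g (Metric.ball x r₀) → ∫ y in Metric.ball x r₀, |g y| ≤ B →
      ∃ c : Word d s → ℝ, (∀ w, |c w| ≤ C) ∧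
        ∀ v ∈ Metric.ball (0 : Space d) r₀, |g (x + v) - poly wordExp c v| ≤ |L| * ‖v‖ ^ s := by
  obtain ⟨C, hC, H⟩ := exists_coeff_bound (wordExp (d := d) (s := s)) r₀
  refine ⟨C * |B + ∫ v in Metric.ball (0 : Space d) r₀, |L| * ‖v‖ ^ s|, by positivity, ?_⟩
  intro g x hg hgi hB
  -- The Taylor coefficients themselves are not bounded by anything assumed. They are replaced by
  -- coefficients of the same polynomial on the ball, controlled by its `L¹` norm, which is at most
  -- that of `g` plus that of the remainder.
  obtain ⟨c, hc1, hc2⟩ := H (taylorCoeff s g x)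
  refine ⟨c, fun w => (hc2 w).trans (mul_le_mul_of_nonneg_left ?_ hC), fun v hv => ?_⟩
  · have hgi' : IntegrableOn (fun v => g (x + v)) (Metric.ball 0 r₀) := by
      have h := (measurePreserving_add_left (volume : Measure (Space d)) x).integrableOn_comp_preimage
        (measurableEmbedding_addLeft x) (f := g) (s := Metric.ball x r₀)
      have h3 : (fun v => x + v) ⁻¹' Metric.ball x r₀ = Metric.ball 0 r₀ := by ext v; simp
      rw [h3] at h
      exact h.2 hgi
    have hLi : IntegrableOn (fun v : Space d => |L| * ‖v‖ ^ s) (Metric.ball 0 r₀) :=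
      ((Continuous.continuousOn (by fun_prop)).integrableOn_compact
        (isCompact_closedBall 0 r₀)).mono_set Metric.ball_subset_closedBall
    refine le_trans ?_ (le_abs_self _)
    calc ∫ v in Metric.ball (0 : Space d) r₀, |poly wordExp (taylorCoeff s g x) v|
        ≤ ∫ v in Metric.ball (0 : Space d) r₀, (|g (x + v)| + |L| * ‖v‖ ^ s) := by
          refine setIntegral_mono_on (integrableOn_poly_ball _ _ _).abs (hgi'.abs.add hLi)
            measurableSet_ball fun v hv => ?_
          have h1 := hg.abs_sub_poly_le hs hv
          have h2 := abs_sub_abs_le_abs_sub (poly wordExp (taylorCoeff s g x) v) (g (x + v))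
          rw [abs_sub_comm] at h2
          linarith
      _ = (∫ v in Metric.ball (0 : Space d) r₀, |g (x + v)|) +
            ∫ v in Metric.ball (0 : Space d) r₀, |L| * ‖v‖ ^ s := integral_add hgi'.abs hLi
      _ ≤ _ := by
          rw [setIntegral_ball_add (fun y => |g y|)]
          linarith
  · rw [hc1 v hv]
    exact hg.abs_sub_poly_le hs hv

/-! ### Moments, bias and tail of the kernel -/

lemma IsRegularKernel.const_pos {d s : ℕ} {CK : ℝ} {K : ℝ → ℝ} (hK : IsRegularKernel d s CK K) :
    0 < CK := by
  by_contra! h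
  have h0 : ∀ u, K u = 0 := fun u => by
    have h1 := hK.decay u
    have h2 := mul_nonpos_of_nonpos_of_nonneg h (Real.exp_pos (-|u| ^ 2 / CK)).le
    exact abs_nonpos_iff.1 (h1.trans h2)
  have := hK.integral_one
  simp [h0] at this

lemma IsRegularKernel.abs_le {d s : ℕ} {CK : ℝ} {K : ℝ → ℝ} (hK : IsRegularKernel d s CK K)
    (u : ℝ) : |K u| ≤ CK := by
  have hp := hK.const_pos
  refine (hK.decay u).trans (mul_le_of_le_one_right hp.le ?_)
  rw [Real.exp_le_one_iff, neg_div]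
  exact neg_nonpos.2 (by positivity)

lemma IsRegularKernel.decay_norm {d s : ℕ} {CK : ℝ} {K : ℝ → ℝ} (hK : IsRegularKernel d s CK K)
    (u : Space d) : |K ‖u‖| ≤ CK * Real.exp (-‖u‖ ^ 2 / CK) := by
  simpa using hK.decay ‖u‖

lemma integrable_norm_pow_mul_gauss {d : ℕ} (hd : 1 ≤ d) {CK : ℝ} (hCK : 0 < CK) (m : ℕ) :
    Integrable fun u : Space d => ‖u‖ ^ m * (CK * Real.exp (-‖u‖ ^ 2 / CK)) := by
  have : Nonempty (Fin d) := ⟨⟨0, hd⟩⟩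
  refine (integrable_fun_norm_addHaar (volume : Measure (Space d))
    (f := fun y => y ^ m * (CK * Real.exp (-y ^ 2 / CK)))).2 ?_
  have h := (integrableOn_rpow_mul_exp_neg_mul_sq (b := 1 / CK) (by positivity)
    (s := ((d - 1 + m : ℕ) : ℝ)) (by linarith [Nat.cast_nonneg (α := ℝ) (d - 1 + m)])).const_mul CK
  refine IntegrableOn.congr_fun h (fun y _ => ?_) measurableSet_Ioi
  simp only [Real.rpow_natCast, finrank_euclideanSpace, Fintype.card_fin, smul_eq_mul]
  rw [pow_add, show -(1 / CK) * y ^ 2 = -y ^ 2 / CK by ring]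
  ring

/-- The moments of the Gaussian majorant of the kernel. -/
noncomputable def gaussMoment (d : ℕ) (CK : ℝ) (m : ℕ) : ℝ :=
  ∫ u : Space d, ‖u‖ ^ m * (CK * Real.exp (-‖u‖ ^ 2 / CK))

lemma gaussMoment_nonneg (d : ℕ) {CK : ℝ} (hCK : 0 < CK) (m : ℕ) : 0 ≤ gaussMoment d CK m :=
  integral_nonneg fun _ => by positivity

lemma measurable_scaledKernel {d : ℕ} {K : ℝ → ℝ} (hK : Measurable K) (σ : ℝ) (x : Space d) :
    Measurable (scaledKernel K σ x) := by
  unfold scaledKernel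
  exact (hK.comp (by fun_prop)).const_mul _

/-- Substitution `y = x + σ u`: the Jacobian cancels `σ^{-d}`. The ball becomes an indicator so that
the integral runs over the whole space, where the moment conditions apply. -/
lemma setIntegral_scaledKernel_mul {d : ℕ} (K : ℝ → ℝ) {σ : ℝ} (hσ : 0 < σ) (x : Space d) (r : ℝ)
    (F : Space d → ℝ) :
    ∫ y in Metric.ball x r, scaledKernel K σ x y * F y =
      ∫ u : Space d, K ‖u‖ * (Metric.ball 0 r).indicator (fun v => F (x + v)) (σ • u) := by
  rw [← setIntegral_ball_add, ← integral_indicator measurableSet_ball]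
  have h := Measure.integral_comp_smul (volume : Measure (Space d))
    (fun v => K ‖σ⁻¹ • v‖ * (Metric.ball 0 r).indicator (fun v => F (x + v)) v) σ
  simp only [smul_smul, inv_mul_cancel₀ hσ.ne', one_smul] at h
  rw [h, smul_eq_mul, ← integral_const_mul]
  refine integral_congr_ae (Filter.Eventually.of_forall fun v => ?_)
  by_cases hv : v ∈ Metric.ball (0 : Space d) r
  · simp only [Set.indicator_of_mem hv, scaledKernel, finrank_euclideanSpace, Fintype.card_fin]
    rw [abs_of_pos (by positivity), sub_add_cancel_left, norm_neg, norm_smul, norm_inv,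
      Real.norm_of_nonneg hσ.le, div_eq_inv_mul ‖v‖, one_div]
    ring
  · simp [Set.indicator_of_notMem hv]

lemma IsRegularKernel.integrable_mul_mono {d s : ℕ} (hd : 1 ≤ d) {CK : ℝ} {K : ℝ → ℝ}
    (hK : IsRegularKernel d s CK K) (a : Fin d → ℕ) :
    Integrable fun u : Space d => K ‖u‖ * mono a u := by
  refine (integrable_norm_pow_mul_gauss hd hK.const_pos (∑ l, a l)).mono'
    ((hK.measurable.comp measurable_norm).mul
      (continuous_mono a).measurable).aestronglyMeasurable (Filter.Eventually.of_forall fun u => ?_)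
  rw [Real.norm_eq_abs, abs_mul, mul_comm]
  exact mul_le_mul (abs_mono_le a u) (hK.decay_norm u) (abs_nonneg _) (by positivity)

lemma IsRegularKernel.abs_integral_mul_mono_le {d s : ℕ} (hd : 1 ≤ d) {CK : ℝ} {K : ℝ → ℝ}
    (hK : IsRegularKernel d s CK K) (a : Fin d → ℕ) :
    |∫ u : Space d, K ‖u‖ * mono a u| ≤ gaussMoment d CK (∑ l, a l) := by
  rw [← Real.norm_eq_abs]
  refine norm_integral_le_of_norm_le (integrable_norm_pow_mul_gauss hd hK.const_pos (∑ l, a l))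
    (Filter.Eventually.of_forall fun u => ?_)
  rw [Real.norm_eq_abs, abs_mul, mul_comm]
  exact mul_le_mul (abs_mono_le a u) (hK.decay_norm u) (abs_nonneg _) (by positivity)

/-- Degree zero is exact by the unit integral, degrees `1` to `s - 1` vanish by the moment
conditions, and from degree `s` on the factor `σ ^ |a|` is at most `σ ^ s`. -/
lemma IsRegularKernel.abs_moment_sub_le {d s : ℕ} (hd : 1 ≤ d) (hs : 1 ≤ s) {CK : ℝ} {K : ℝ → ℝ}
    (hK : IsRegularKernel d s CK K) {σ : ℝ} (hσ : 0 < σ) (hσ1 : σ ≤ 1) (a : Fin d → ℕ) :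
    |σ ^ (∑ l, a l) * (∫ u : Space d, K ‖u‖ * mono a u) - mono a (0 : Space d)| ≤
      σ ^ s * gaussMoment d CK (∑ l, a l) := by
  have hG := gaussMoment_nonneg d hK.const_pos (∑ l, a l)
  rcases Nat.eq_zero_or_pos (∑ l, a l) with h0 | h0
  · simp only [mono_eq_one a h0, h0, pow_zero, mul_one, hK.integral_one, sub_self, abs_zero]
    rw [h0] at hG
    positivity
  · rw [mono_zero_apply a h0, sub_zero]
    rcases Nat.lt_or_ge (∑ l, a l) s with h1 | h1
    · have h2 := hK.moments a h0 (by omega)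
      have h3 : ∫ u : Space d, K ‖u‖ * mono a u = 0 := by
        rw [← h2]
        exact integral_congr_ae (Filter.Eventually.of_forall fun u => mul_comm _ _)
      rw [h3, mul_zero, abs_zero]
      positivity
    · rw [abs_mul, abs_of_pos (by positivity)]
      exact mul_le_mul (pow_le_pow_of_le_one hσ.le hσ1 h1) (hK.abs_integral_mul_mono_le hd a)
        (abs_nonneg _) (by positivity)

/-- The kernel average of a function with a polynomial approximation at `x` differs from the value
of the polynomial at `x` by `O(σ ^ s)`. -/
lemma exists_kernel_bias {d s : ℕ} (hd : 1 ≤ d) (hs : 1 ≤ s) {CK r₀ B : ℝ} (hCK : 0 < CK)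
    (hr₀ : 0 < r₀) (hB : 0 ≤ B) {ι : Type*} [Fintype ι] (a : ι → Fin d → ℕ) :
    ∃ C : ℝ, 0 ≤ C ∧ ∀ (K : ℝ → ℝ) (σ : ℝ) (x : Space d) (h : Space d → ℝ) (c : ι → ℝ),
      IsRegularKernel d s CK K → 0 < σ → σ ≤ 1 → Measurable h → (∀ i, |c i| ≤ B) →
      (∀ v ∈ Metric.ball (0 : Space d) r₀, |h (x + v) - poly a c v| ≤ B * ‖v‖ ^ s) →
      |(∫ y in Metric.ball x r₀, scaledKernel K σ x y * h y) - poly a c 0| ≤ C * σ ^ s := by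
  let G : Space d → ℝ := fun u => CK * Real.exp (-‖u‖ ^ 2 / CK)
  -- Majorant of `σ^{-s} |F - Q|`, where `F` uses `h` cut off to the ball and `Q` the polynomial on
  -- all of space. The first term is the remainder inside the ball. Outside, `F = 0` and only the
  -- polynomial remains; there `(σ‖u‖/r₀)^s ≥ 1` supplies the missing power of `σ`.
  let D : Space d → ℝ := fun u =>
    B * (‖u‖ ^ s * G u) + ∑ i, B / r₀ ^ s * (‖u‖ ^ (∑ l, a i l + s) * G u)
  have hDi : Integrable D :=
    ((integrable_norm_pow_mul_gauss hd hCK s).const_mul B).add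
      (integrable_finsetSum _ fun i _ => (integrable_norm_pow_mul_gauss hd hCK _).const_mul _)
  have hD0 : ∀ u, 0 ≤ D u := fun u => by positivity
  refine ⟨(∫ u, D u) + ∑ i, B * gaussMoment d CK (∑ l, a i l), add_nonneg (integral_nonneg hD0)
    (Finset.sum_nonneg fun i _ => mul_nonneg hB (gaussMoment_nonneg d hCK _)), ?_⟩
  intro K σ x h c hK hσ hσ1 hh hc hj
  rw [setIntegral_scaledKernel_mul K hσ]
  set F : Space d → ℝ := fun u =>
    K ‖u‖ * (Metric.ball 0 r₀).indicator (fun v => h (x + v)) (σ • u) with hF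
  set Q : Space d → ℝ := fun u => K ‖u‖ * poly a c (σ • u) with hQ
  have hQ' : Q = fun u => ∑ i, c i * σ ^ (∑ l, a i l) * (K ‖u‖ * mono (a i) u) := by
    funext u
    simp only [hQ, poly, mono_smul, Finset.mul_sum]
    exact Finset.sum_congr rfl fun i _ => by ring
  have hQi : Integrable Q := by
    rw [hQ']
    exact integrable_finsetSum _ fun i _ => (hK.integrable_mul_mono hd (a i)).const_mul _
  have hFm : Measurable F := by
    refine (hK.measurable.comp measurable_norm).mul ?_
    exact ((hh.comp (measurable_const_add x)).indicator measurableSet_ball).comp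
      (measurable_const_smul σ)
  have hFQ : ∀ u, |F u - Q u| ≤ σ ^ s * D u := fun u => by
    have hG : |K ‖u‖| ≤ G u := hK.decay_norm u
    have hG0 : 0 ≤ G u := (abs_nonneg _).trans hG
    have hnu : ‖σ • u‖ = σ * ‖u‖ := by rw [norm_smul, Real.norm_of_nonneg hσ.le]
    simp only [hF, hQ]
    rw [← mul_sub, abs_mul]
    by_cases hv : σ • u ∈ Metric.ball (0 : Space d) r₀
    · rw [Set.indicator_of_mem hv]
      have h1 := hj _ hv
      rw [hnu] at h1
      calc |K ‖u‖| * |h (x + σ • u) - poly a c (σ • u)| ≤ G u * (B * (σ * ‖u‖) ^ s) :=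
            mul_le_mul hG h1 (abs_nonneg _) hG0
        _ = σ ^ s * (B * (‖u‖ ^ s * G u)) := by ring
        _ ≤ σ ^ s * D u := by
            refine mul_le_mul_of_nonneg_left (le_add_of_nonneg_right ?_) (by positivity)
            exact Finset.sum_nonneg fun i _ => by positivity
    · rw [Set.indicator_of_notMem hv, zero_sub, abs_neg]
      rw [mem_ball_zero_iff, not_lt, hnu] at hv
      have h1 : 1 ≤ (σ * ‖u‖ / r₀) ^ s := one_le_pow₀ ((one_le_div hr₀).2 hv)
      calc |K ‖u‖| * |poly a c (σ • u)|
          ≤ G u * (B * ∑ i, ‖σ • u‖ ^ ∑ l, a i l) :=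
            mul_le_mul hG (abs_poly_le a hc _) (abs_nonneg _) hG0
        _ ≤ G u * (B * ∑ i, ‖u‖ ^ (∑ l, a i l) * (σ * ‖u‖ / r₀) ^ s) := by
            refine mul_le_mul_of_nonneg_left (mul_le_mul_of_nonneg_left
              (Finset.sum_le_sum fun i _ => ?_) hB) hG0
            have h2 : ‖σ • u‖ ^ (∑ l, a i l) ≤ ‖u‖ ^ (∑ l, a i l) := by
              refine pow_le_pow_left₀ (norm_nonneg _) ?_ _
              rw [hnu]
              exact mul_le_of_le_one_left (norm_nonneg _) hσ1
            exact h2.trans (le_mul_of_one_le_right (by positivity) h1)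
        _ = σ ^ s * ∑ i, B / r₀ ^ s * (‖u‖ ^ (∑ l, a i l + s) * G u) := by
            simp only [Finset.mul_sum]
            refine Finset.sum_congr rfl fun i _ => ?_
            rw [div_pow, mul_pow, pow_add]
            ring
        _ ≤ σ ^ s * D u := by
            refine mul_le_mul_of_nonneg_left (le_add_of_nonneg_left ?_) (by positivity)
            positivity
  have hFQi : Integrable fun u => F u - Q u :=
    (hDi.const_mul (σ ^ s)).mono' (hFm.aestronglyMeasurable.sub hQi.aestronglyMeasurable)
      (Filter.Eventually.of_forall hFQ)
  have h1 : |∫ u, (F u - Q u)| ≤ σ ^ s * ∫ u, D u := by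
    rw [← integral_const_mul, ← Real.norm_eq_abs]
    exact norm_integral_le_of_norm_le (hDi.const_mul _) (Filter.Eventually.of_forall hFQ)
  have h2 : |(∫ u, Q u) - poly a c 0| ≤ σ ^ s * ∑ i, B * gaussMoment d CK (∑ l, a i l) := by
    rw [hQ', integral_finsetSum _ fun i _ => (hK.integrable_mul_mono hd (a i)).const_mul _, poly,
      ← Finset.sum_sub_distrib, Finset.mul_sum]
    refine (Finset.abs_sum_le_sum_abs _ _).trans (Finset.sum_le_sum fun i _ => ?_)
    rw [integral_const_mul, mul_assoc, ← mul_sub, abs_mul, mul_left_comm]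
    exact mul_le_mul (hc i) (hK.abs_moment_sub_le hd hs hσ hσ1 (a i)) (abs_nonneg _) hB
  have h3 : ∫ u, F u = (∫ u, (F u - Q u)) + ∫ u, Q u := by
    rw [← integral_add hFQi hQi]
    simp
  rw [h3, add_sub_assoc]
  refine (abs_add_le _ _).trans ?_
  linarith

/-- Gaussian decay beats every power of `σ`: `e^{-t} ≤ N!/t^N` with `N = d + s` and `t =
(r₀/σ)^2/CK` gives `σ^{2(d+s)}`, which absorbs the normalisation `σ^{-d}` and still leaves `σ^s`. -/
lemma exists_kernel_tail (d s : ℕ) {CK r₀ : ℝ} (hCK : 0 < CK) (hr₀ : 0 < r₀) :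
    ∃ C : ℝ, 0 ≤ C ∧ ∀ (K : ℝ → ℝ) (σ : ℝ) (x y : Space d), IsRegularKernel d s CK K →
      0 < σ → σ ≤ 1 → r₀ ≤ ‖x - y‖ → |scaledKernel K σ x y| ≤ C * σ ^ s := by
  refine ⟨CK * ((d + s).factorial * (CK / r₀ ^ 2) ^ (d + s)), by positivity, ?_⟩
  intro K σ x y hK hσ hσ1 hxy
  rw [scaledKernel, abs_mul, abs_of_pos (by positivity)]
  set t : ℝ := (r₀ / σ) ^ 2 / CK with ht
  have ht0 : 0 < t := by positivity
  have h1 : |K (‖x - y‖ / σ)| ≤ CK * Real.exp (-t) := by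
    refine (hK.decay _).trans (mul_le_mul_of_nonneg_left (Real.exp_le_exp.2 ?_) hCK.le)
    rw [neg_div, neg_le_neg_iff, ht, abs_of_nonneg (by positivity)]
    gcongr
  have h2 : Real.exp (-t) ≤ (d + s).factorial / t ^ (d + s) := by
    rw [Real.exp_neg, inv_le_comm₀ (Real.exp_pos _) (by positivity), inv_div]
    exact Real.pow_div_factorial_le_exp t ht0.le _
  calc 1 / σ ^ d * |K (‖x - y‖ / σ)|
      ≤ 1 / σ ^ d * (CK * ((d + s).factorial / t ^ (d + s))) := by gcongr; exact h1.trans (by gcongr)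
    _ = CK * ((d + s).factorial * (CK / r₀ ^ 2) ^ (d + s)) * (σ ^ s * σ ^ (d + s)) := by
        rw [ht]
        field_simp
        rw [div_pow, mul_pow, div_pow]
        field_simp
        ring
    _ ≤ CK * ((d + s).factorial * (CK / r₀ ^ 2) ^ (d + s)) * (σ ^ s * 1) := by
        gcongr
        exact pow_le_one₀ hσ.le hσ1
    _ = _ := by rw [mul_one]

lemma IsRegularKernel.abs_scaledKernel_le {d s : ℕ} {CK : ℝ} {K : ℝ → ℝ}
    (hK : IsRegularKernel d s CK K) {σ : ℝ} (hσ : 0 < σ) (x y : Space d) :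
    |scaledKernel K σ x y| ≤ 1 / σ ^ d * CK := by
  rw [scaledKernel, abs_mul, abs_of_pos (by positivity)]
  exact mul_le_mul_of_nonneg_left (hK.abs_le _) (by positivity)

/-! ### Biases of the degree and of the numerator, uniformly over models -/

namespace IsRegressionModel

variable {d s : ℕ} {Cf Lf Lμ r₀ σe : ℝ} {M : Set (Space d)} {μ f : Space d → ℝ} {x₀ : Space d}

lemma ae_mem (h : IsRegressionModel s Cf Lf Lμ r₀ M μ f σe x₀) : ∀ᵐ x ∂designLaw μ, x ∈ M :=
  h.design_support

lemma lintegral_density (h : IsRegressionModel s Cf Lf Lμ r₀ M μ f σe x₀) :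
    ∫⁻ x, ENNReal.ofReal (μ x) = 1 := by
  have := h.design_prob.measure_univ
  rwa [designLaw, withDensity_apply _ MeasurableSet.univ, setLIntegral_univ] at this

lemma integrable_density (h : IsRegressionModel s Cf Lf Lμ r₀ M μ f σe x₀) : Integrable μ := by
  refine ⟨h.density_measurable.aestronglyMeasurable, ?_⟩
  rw [hasFiniteIntegral_iff_ofReal (Filter.Eventually.of_forall h.density_nonneg),
    h.lintegral_density]
  exact ENNReal.one_lt_top

lemma integral_density (h : IsRegressionModel s Cf Lf Lμ r₀ M μ f σe x₀) : ∫ x, μ x = 1 := by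
  rw [integral_eq_lintegral_of_nonneg_ae (Filter.Eventually.of_forall h.density_nonneg)
    h.density_measurable.aestronglyMeasurable, h.lintegral_density, ENNReal.toReal_one]

lemma setIntegral_designLaw (h : IsRegressionModel s Cf Lf Lμ r₀ M μ f σe x₀) {S : Set (Space d)}
    (hS : MeasurableSet S) (g : Space d → ℝ) :
    ∫ x in S, g x ∂designLaw μ = ∫ x in S, μ x * g x := by
  rw [designLaw, setIntegral_withDensity_eq_setIntegral_toReal_smul
    h.density_measurable.ennreal_ofReal (Filter.Eventually.of_forall fun _ => ENNReal.ofReal_lt_top)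
    g hS]
  simp only [ENNReal.toReal_ofReal (h.density_nonneg _), smul_eq_mul]

lemma abs_apply_le (h : IsRegressionModel s Cf Lf Lμ r₀ M μ f σe x₀) {v : Space d}
    (hv : v ∈ Metric.ball 0 r₀) : |f (x₀ + v)| ≤ Cf :=
  h.f_bound _ (h.interior (by simpa using hv))

lemma noise_const_nonneg (h : IsRegressionModel s Cf Lf Lμ r₀ M μ f σe x₀) : 0 ≤ Cf :=
  h.noise_nonneg.trans h.noise_bound

lemma integrable_of_bound (h : IsRegressionModel s Cf Lf Lμ r₀ M μ f σe x₀) {g : Space d → ℝ}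
    (hg : Measurable g) (B : ℝ) (hB : ∀ x ∈ M, |g x| ≤ B) : Integrable g (designLaw μ) := by
  have := h.design_prob
  exact Integrable.of_bound hg.aestronglyMeasurable B (h.ae_mem.mono hB)

lemma integrable_scaledKernel_mul (h : IsRegressionModel s Cf Lf Lμ r₀ M μ f σe x₀) {CK : ℝ}
    {K : ℝ → ℝ} (hK : IsRegularKernel d s CK K) {σ : ℝ} (hσ : 0 < σ) {g : Space d → ℝ}
    (hg : Measurable g) (H : ℝ) (hH : ∀ x ∈ M, |g x| ≤ H) :
    Integrable (fun x => scaledKernel K σ x₀ x * g x) (designLaw μ) := by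
  have hCK := hK.const_pos
  refine h.integrable_of_bound ((measurable_scaledKernel hK.measurable σ x₀).mul hg)
    (1 / σ ^ d * CK * H) fun x hx => ?_
  rw [abs_mul]
  exact mul_le_mul (hK.abs_scaledKernel_le hσ _ _) (hH x hx) (abs_nonneg _) (by positivity)

lemma abs_setIntegral_compl_ball_le (h : IsRegressionModel s Cf Lf Lμ r₀ M μ f σe x₀)
    {g : Space d → ℝ} {B : ℝ} (hB0 : 0 ≤ B) (hB : ∀ x ∈ M, x ∉ Metric.ball x₀ r₀ → |g x| ≤ B) :
    |∫ x in (Metric.ball x₀ r₀)ᶜ, g x ∂designLaw μ| ≤ B := by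
  have := h.design_prob
  rw [← Real.norm_eq_abs]
  refine (norm_setIntegral_le_of_norm_le_const_ae' (C := B) (measure_lt_top _ _) ?_).trans ?_
  · filter_upwards [h.ae_mem] with x hx hxb using hB x hx hxb
  · exact mul_le_of_le_one_right hB0 measureReal_le_one

end IsRegressionModel

/-- Uniformly over regression models, the density has a polynomial approximation at the query
point with bounded coefficients. -/
lemma exists_density_jet (d s : ℕ) (hs : 1 ≤ s) (Cf Lf Lμ r₀ : ℝ) :
    ∃ C : ℝ, 0 ≤ C ∧ ∀ (M : Set (Space d)) (μ f : Space d → ℝ) (σe : ℝ) (x₀ : Space d),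
      IsRegressionModel s Cf Lf Lμ r₀ M μ f σe x₀ →
      ∃ c : Word d s → ℝ, (∀ w, |c w| ≤ C) ∧
        ∀ v ∈ Metric.ball (0 : Space d) r₀, |μ (x₀ + v) - poly wordExp c v| ≤ |Lμ| * ‖v‖ ^ s := by
  -- The `L¹` bound `1` is the total mass of the density.
  obtain ⟨C, hC, H⟩ := exists_jet d s hs Lμ r₀ 1
  refine ⟨C, hC, fun M μ f σe x₀ h => H μ x₀ h.density_smooth h.integrable_density.integrableOn ?_⟩
  simp only [abs_of_nonneg (h.density_nonneg _)]
  rw [← h.integral_density]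
  exact setIntegral_le_integral h.integrable_density (Filter.Eventually.of_forall h.density_nonneg)

/-- Uniformly over regression models, the regression function has a polynomial approximation at the
query point with bounded coefficients. -/
lemma exists_regression_jet (d s : ℕ) (hs : 1 ≤ s) (Cf Lf Lμ r₀ : ℝ) :
    ∃ C : ℝ, 0 ≤ C ∧ ∀ (M : Set (Space d)) (μ f : Space d → ℝ) (σe : ℝ) (x₀ : Space d),
      IsRegressionModel s Cf Lf Lμ r₀ M μ f σe x₀ →
      ∃ c : Word d s → ℝ, (∀ w, |c w| ≤ C) ∧
        ∀ v ∈ Metric.ball (0 : Space d) r₀, |f (x₀ + v) - poly wordExp c v| ≤ |Lf| * ‖v‖ ^ s := by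
  obtain ⟨C, hC, H⟩ := exists_jet d s hs Lf r₀ (∫ _ in Metric.ball (0 : Space d) r₀, Cf)
  refine ⟨C, hC, fun M μ f σe x₀ h => ?_⟩
  have hfi : IntegrableOn f (Metric.ball x₀ r₀) :=
    Measure.integrableOn_of_bounded measure_ball_lt_top.ne h.f_measurable.aestronglyMeasurable (M := Cf)
      (by
        filter_upwards [ae_restrict_mem measurableSet_ball] with x hx
        exact h.f_bound x (h.interior hx))
  refine H f x₀ h.f_smooth hfi ?_
  rw [setIntegral_ball_add (fun _ => Cf) x₀]
  exact setIntegral_mono_on hfi.abs (integrableOn_const measure_ball_lt_top.ne) measurableSet_ball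
    fun x hx => h.f_bound x (h.interior hx)

/-- Uniformly over regression models, the density is bounded near the query point. -/
lemma exists_density_bound (d s : ℕ) (hs : 1 ≤ s) (Cf Lf Lμ : ℝ) {r₀ : ℝ} (hr₀ : 0 < r₀) :
    ∃ C : ℝ, 0 ≤ C ∧ ∀ (M : Set (Space d)) (μ f : Space d → ℝ) (σe : ℝ) (x₀ : Space d),
      IsRegressionModel s Cf Lf Lμ r₀ M μ f σe x₀ →
      ∀ v ∈ Metric.ball (0 : Space d) r₀, μ (x₀ + v) ≤ C := by
  obtain ⟨C, hC, H⟩ := exists_density_jet d s hs Cf Lf Lμ r₀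
  refine ⟨|Lμ| * r₀ ^ s + C * ∑ w : Word d s, r₀ ^ ∑ l, wordExp w l, by positivity, ?_⟩
  intro M μ f σe x₀ h v hv
  obtain ⟨c, hc, hj⟩ := H M μ f σe x₀ h
  have h1 := (le_abs_self _).trans (hj v hv)
  have h2 := (le_abs_self _).trans (abs_poly_le_of_mem_ball wordExp hc hC hv)
  have h3 : |Lμ| * ‖v‖ ^ s ≤ |Lμ| * r₀ ^ s := by
    gcongr
    exact (mem_ball_zero_iff.1 hv).le
  linarith

/-- The bias of the degree function. -/
lemma exists_degree_bias {d s : ℕ} (hd : 1 ≤ d) (hs : 1 ≤ s) (Cf Lf Lμ : ℝ) {r₀ CK : ℝ}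
    (hr₀ : 0 < r₀) (hCK : 0 < CK) :
    ∃ C : ℝ, 0 ≤ C ∧ ∀ (M : Set (Space d)) (μ f : Space d → ℝ) (σe : ℝ) (x₀ : Space d)
      (K : ℝ → ℝ) (σ : ℝ), IsRegressionModel s Cf Lf Lμ r₀ M μ f σe x₀ →
      IsRegularKernel d s CK K → 0 < σ → σ ≤ 1 →
      |∫ x, scaledKernel K σ x₀ x ∂designLaw μ - μ x₀| ≤ C * σ ^ s := by
  obtain ⟨Cj, hCj, Hj⟩ := exists_density_jet d s hs Cf Lf Lμ r₀
  obtain ⟨Cb, hCb, Hb⟩ := exists_kernel_bias hd hs hCK hr₀ (B := max Cj |Lμ|)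
    (hCj.trans (le_max_left _ _)) (wordExp (d := d) (s := s))
  obtain ⟨Ct, hCt, Ht⟩ := exists_kernel_tail d s hCK hr₀
  refine ⟨Cb + Ct, by positivity, fun M μ f σe x₀ K σ h hK hσ hσ1 => ?_⟩
  obtain ⟨c, hc, hj⟩ := Hj M μ f σe x₀ h
  -- Since `s ≥ 1`, the remainder vanishes at `v = 0`, so the replaced polynomial still has the
  -- right value there.
  have h0 : poly wordExp c 0 = μ x₀ := by
    have := hj 0 (Metric.mem_ball_self hr₀)
    rw [norm_zero, zero_pow (by omega), mul_zero, add_zero] at this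
    linarith [abs_nonpos_iff.1 this]
  have h1 := Hb K σ x₀ μ c hK hσ hσ1 h.density_measurable
    (fun w => (hc w).trans (le_max_left _ _)) fun v hv => (hj v hv).trans (by
      gcongr
      exact le_max_right _ _)
  have hi : Integrable (scaledKernel K σ x₀) (designLaw μ) :=
    h.integrable_of_bound (measurable_scaledKernel hK.measurable σ x₀) _
      fun x _ => hK.abs_scaledKernel_le hσ x₀ x
  have h2 := h.abs_setIntegral_compl_ball_le (g := scaledKernel K σ x₀) (B := Ct * σ ^ s)
    (by positivity) fun x _ hx => Ht K σ x₀ x hK hσ hσ1 (by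
      rw [Metric.mem_ball, not_lt, dist_comm, dist_eq_norm] at hx
      exact hx)
  have h3 := integral_add_compl (measurableSet_ball (x := x₀) (ε := r₀)) hi
  rw [h.setIntegral_designLaw measurableSet_ball] at h3
  simp only [mul_comm (μ _)] at h3
  rw [← h3, ← h0, add_sub_right_comm, add_mul]
  exact (abs_add_le _ _).trans (add_le_add h1 h2)

/-- The bias of the numerator of the Nadaraya-Watson estimator. -/
lemma exists_numerator_bias {d s : ℕ} (hd : 1 ≤ d) (hs : 1 ≤ s) (Cf Lf Lμ : ℝ) {r₀ CK : ℝ}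
    (hr₀ : 0 < r₀) (hCK : 0 < CK) :
    ∃ C : ℝ, 0 ≤ C ∧ ∀ (M : Set (Space d)) (μ f : Space d → ℝ) (σe : ℝ) (x₀ : Space d)
      (K : ℝ → ℝ) (σ : ℝ), IsRegressionModel s Cf Lf Lμ r₀ M μ f σe x₀ →
      IsRegularKernel d s CK K → 0 < σ → σ ≤ 1 →
      |∫ x, scaledKernel K σ x₀ x * f x ∂designLaw μ - f x₀ * μ x₀| ≤ C * σ ^ s := by
  obtain ⟨Cj, hCj, Hj⟩ := exists_density_jet d s hs Cf Lf Lμ r₀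
  obtain ⟨Ci, hCi, Hi⟩ := exists_regression_jet d s hs Cf Lf Lμ r₀
  -- With `p` and `q` the polynomials of `μ` and `f`, `fμ - qp = f(μ - p) + p(f - q)`, and `P`
  -- bounds `p` on the ball. `B` dominates both the coefficients of `qp` and this remainder. Terms
  -- of `qp` of degree `s` or more are harmless in the kernel bias.
  set P : ℝ := Cj * ∑ w : Word d s, r₀ ^ ∑ l, wordExp w l with hP
  have hP0 : 0 ≤ P := by positivity
  set B : ℝ := max (Ci * Cj) (|Cf| * |Lμ| + P * |Lf|) with hBdef
  have hB0 : 0 ≤ B := (mul_nonneg hCi hCj).trans (le_max_left _ _)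
  obtain ⟨Cb, hCb, Hb⟩ := exists_kernel_bias hd hs hCK hr₀ hB0
    (fun p : Word d s × Word d s => wordExp p.1 + wordExp p.2)
  obtain ⟨Ct, hCt, Ht⟩ := exists_kernel_tail d s hCK hr₀
  refine ⟨Cb + Ct * |Cf|, by positivity, fun M μ f σe x₀ K σ h hK hσ hσ1 => ?_⟩
  obtain ⟨c, hc, hj⟩ := Hj M μ f σe x₀ h
  obtain ⟨e, he, hi⟩ := Hi M μ f σe x₀ h
  have hCf := h.noise_const_nonneg
  have hjet : ∀ v ∈ Metric.ball (0 : Space d) r₀,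
      |f (x₀ + v) * μ (x₀ + v) - poly (fun p : Word d s × Word d s => wordExp p.1 + wordExp p.2)
        (fun p => e p.1 * c p.2) v| ≤ (|Cf| * |Lμ| + P * |Lf|) * ‖v‖ ^ s := fun v hv => by
    rw [← poly_mul]
    have h1 : |f (x₀ + v)| ≤ |Cf| := (h.abs_apply_le hv).trans (le_abs_self _)
    have h2 := abs_poly_le_of_mem_ball wordExp hc hCj hv
    calc _ = |f (x₀ + v) * (μ (x₀ + v) - poly wordExp c v) +
          poly wordExp c v * (f (x₀ + v) - poly wordExp e v)| := by ring_nf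
      _ ≤ |Cf| * (|Lμ| * ‖v‖ ^ s) + P * (|Lf| * ‖v‖ ^ s) := by
          refine (abs_add_le _ _).trans (add_le_add ?_ ?_) <;> rw [abs_mul]
          · exact mul_le_mul h1 (hj v hv) (abs_nonneg _) (abs_nonneg _)
          · exact mul_le_mul h2 (hi v hv) (abs_nonneg _) hP0
      _ = _ := by ring
  have h0 : poly (fun p : Word d s × Word d s => wordExp p.1 + wordExp p.2)
      (fun p => e p.1 * c p.2) 0 = f x₀ * μ x₀ := by
    have := hjet 0 (Metric.mem_ball_self hr₀)
    rw [norm_zero, zero_pow (by omega), mul_zero, add_zero] at this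
    linarith [abs_nonpos_iff.1 this]
  have h1 := Hb K σ x₀ (fun x => f x * μ x) (fun p => e p.1 * c p.2) hK hσ hσ1
    (h.f_measurable.mul h.density_measurable)
    (fun p => by
      rw [abs_mul]
      exact (mul_le_mul (he _) (hc _) (abs_nonneg _) hCi).trans (le_max_left _ _))
    fun v hv => (hjet v hv).trans (by
      gcongr
      exact le_max_right _ _)
  have hint := h.integrable_scaledKernel_mul hK hσ h.f_measurable Cf h.f_bound
  have h2 := h.abs_setIntegral_compl_ball_le (g := fun x => scaledKernel K σ x₀ x * f x)
    (B := Ct * σ ^ s * |Cf|) (by positivity) fun x hxM hx => by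
      rw [Metric.mem_ball, not_lt, dist_comm, dist_eq_norm] at hx
      rw [abs_mul]
      exact mul_le_mul (Ht K σ x₀ x hK hσ hσ1 hx) ((h.f_bound x hxM).trans (le_abs_self _))
        (abs_nonneg _) (by positivity)
  have h3 := integral_add_compl (measurableSet_ball (x := x₀) (ε := r₀)) hint
  rw [h.setIntegral_designLaw measurableSet_ball] at h3
  simp only [mul_comm (μ _), mul_assoc] at h3
  rw [← h3, ← h0, add_sub_right_comm]
  refine ((abs_add_le _ _).trans (add_le_add h1 h2)).trans (le_of_eq (by ring))

/-- The kernel weights are bounded in mean. -/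
lemma exists_abs_kernel_bound {d s : ℕ} (hd : 1 ≤ d) (hs : 1 ≤ s) (Cf Lf Lμ : ℝ) {r₀ CK : ℝ}
    (hr₀ : 0 < r₀) (hCK : 0 < CK) :
    ∃ C : ℝ, 0 ≤ C ∧ ∀ (M : Set (Space d)) (μ f : Space d → ℝ) (σe : ℝ) (x₀ : Space d)
      (K : ℝ → ℝ) (σ : ℝ), IsRegressionModel s Cf Lf Lμ r₀ M μ f σe x₀ →
      IsRegularKernel d s CK K → 0 < σ → σ ≤ 1 →
      ∫ x, |scaledKernel K σ x₀ x| ∂designLaw μ ≤ C := by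
  obtain ⟨Cm, hCm, Hm⟩ := exists_density_bound d s hs Cf Lf Lμ hr₀
  obtain ⟨Ct, hCt, Ht⟩ := exists_kernel_tail d s hCK hr₀
  refine ⟨Cm * gaussMoment d CK 0 + Ct, by have := gaussMoment_nonneg d hCK 0; positivity,
    fun M μ f σe x₀ K σ h hK hσ hσ1 => ?_⟩
  have hi : Integrable (fun x => |scaledKernel K σ x₀ x|) (designLaw μ) :=
    (h.integrable_of_bound (measurable_scaledKernel hK.measurable σ x₀) _
      fun x _ => hK.abs_scaledKernel_le hσ x₀ x).abs
  have h2 := h.abs_setIntegral_compl_ball_le (g := fun x => |scaledKernel K σ x₀ x|) (B := Ct)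
    (by positivity) fun x _ hx => by
      rw [abs_abs]
      refine (Ht K σ x₀ x hK hσ hσ1 (by
        rw [Metric.mem_ball, not_lt, dist_comm, dist_eq_norm] at hx
        exact hx)).trans (mul_le_of_le_one_right hCt (pow_le_one₀ hσ.le hσ1))
  rw [← integral_add_compl (measurableSet_ball (x := x₀) (ε := r₀)) hi,
    h.setIntegral_designLaw measurableSet_ball]
  refine add_le_add ?_ ((le_abs_self _).trans h2)
  -- The change of variables needs no regularity of the profile, so it applies to `|K|`.
  have habs : ∀ x, μ x * |scaledKernel K σ x₀ x| =
      scaledKernel (fun u => |K u|) σ x₀ x * μ x := fun x => by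
    rw [scaledKernel, scaledKernel, abs_mul, abs_of_pos (a := 1 / σ ^ d) (by positivity), mul_comm]
  simp only [habs]
  rw [setIntegral_scaledKernel_mul _ hσ, gaussMoment, ← integral_const_mul]
  refine integral_mono_of_nonneg (Filter.Eventually.of_forall fun u => ?_)
    ((integrable_norm_pow_mul_gauss hd hCK 0).const_mul Cm) (Filter.Eventually.of_forall fun u => ?_)
  · exact mul_nonneg (abs_nonneg _) (Set.indicator_nonneg (fun _ _ => h.density_nonneg _) _)
  · have h4 : (Metric.ball 0 r₀).indicator (fun v => μ (x₀ + v)) (σ • u) ≤ Cm := by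
      by_cases hv : σ • u ∈ Metric.ball (0 : Space d) r₀
      · rw [Set.indicator_of_mem hv]
        exact Hm M μ f σe x₀ h _ hv
      · rw [Set.indicator_of_notMem hv]
        exact hCm
    have h5 := hK.decay_norm u
    simp only [pow_zero, one_mul]
    rw [mul_comm Cm]
    exact mul_le_mul h5 h4 (Set.indicator_nonneg (fun _ _ => h.density_nonneg _) _) (by positivity)

/-! ### Second moments of i.i.d. sums and the clipping bias -/

lemma memLp_sum_pi {Z : Type*} [MeasurableSpace Z] (P : Measure Z) [IsProbabilityMeasure P]
    {g : Z → ℝ} (hg : MemLp g 2 P) (n : ℕ) :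
    MemLp (fun z : Fin n → Z => ∑ i, g (z i)) 2 (Measure.pi fun _ => P) :=
  memLp_finsetSum _ fun i _ => hg.comp_measurePreserving (measurePreserving_eval (fun _ => P) i)

/-- The second moment of a sum of independent identically distributed variables. -/
lemma integral_sum_sq_pi_le {Z : Type*} [MeasurableSpace Z] (P : Measure Z)
    [IsProbabilityMeasure P] {g : Z → ℝ} (hg : MemLp g 2 P) (n : ℕ) :
    ∫ z : Fin n → Z, (∑ i, g (z i)) ^ 2 ∂(Measure.pi fun _ => P) ≤
      n * ∫ z, g z ^ 2 ∂P + (n * ∫ z, g z ∂P) ^ 2 := by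
  set Q : Measure (Fin n → Z) := Measure.pi fun _ => P
  have hmp : ∀ i : Fin n, MeasurePreserving (Function.eval i) Q P :=
    fun i => measurePreserving_eval (fun _ => P) i
  have hgi : ∀ i : Fin n, MemLp (fun z : Fin n → Z => g (z i)) 2 Q :=
    fun i => hg.comp_measurePreserving (hmp i)
  have hS := memLp_sum_pi P hg n
  have hind : iIndepFun (fun (i : Fin n) (z : Fin n → Z) => g (z i)) Q :=
    iIndepFun_pi (X := fun _ => g) fun _ => hg.1.aemeasurable
  have h1 := IndepFun.variance_sum (s := Finset.univ) (fun i _ => hgi i)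
    (fun i _ j _ hij => hind.indepFun hij)
  have hmean : ∀ i : Fin n, ∫ z, g (z i) ∂Q = ∫ z, g z ∂P := fun i => by
    rw [← (hmp i).map_eq, integral_map (hmp i).aemeasurable (by rw [(hmp i).map_eq]; exact hg.1)]
  have hsq : ∀ i : Fin n, ∫ z, g (z i) ^ 2 ∂Q = ∫ z, g z ^ 2 ∂P := fun i => by
    rw [← (hmp i).map_eq,
      integral_map (hmp i).aemeasurable (by rw [(hmp i).map_eq]; exact hg.1.pow 2)]
  have h2 : Var[fun z : Fin n → Z => ∑ i, g (z i); Q] ≤ n * ∫ z, g z ^ 2 ∂P := by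
    have h3 : (fun z : Fin n → Z => ∑ i, g (z i)) = ∑ i : Fin n, fun z : Fin n → Z => g (z i) := by
      funext z; simp
    rw [h3, h1]
    calc _ ≤ ∑ _i : Fin n, ∫ z, g z ^ 2 ∂P := Finset.sum_le_sum fun i _ => by
          rw [← hsq i]
          exact variance_le_expectation_sq (hgi i).1
      _ = _ := by simp
  rw [variance_eq_sub hS, integral_finsetSum _ fun i _ => (hgi i).integrable one_le_two] at h2
  simp only [hmean, Finset.sum_const, Finset.card_univ, Fintype.card_fin, nsmul_eq_mul,
    Pi.pow_apply] at h2
  linarith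

lemma clip_mem {R : ℝ} (hR : 0 ≤ R) (y : ℝ) : |clip R y| ≤ R := by
  rw [abs_le, clip]
  exact ⟨le_max_left _ _, max_le (by linarith) (min_le_left _ _)⟩

lemma measurable_clip (R : ℝ) : Measurable (clip R) :=
  measurable_const.max (measurable_const.min measurable_id)

/-- Clipping is nonexpansive and fixes every `θ` with `|θ| ≤ R`. -/
lemma abs_clip_sub_le {R : ℝ} (y : ℝ) {θ : ℝ} (hθ : |θ| ≤ R) :
    |clip R y - θ| ≤ |y - θ| := by
  have h1 : clip R θ = θ := by
    rw [abs_le] at hθ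
    rw [clip, min_eq_right hθ.2, max_eq_right hθ.1]
  conv_lhs => rw [← h1]
  unfold clip
  exact (abs_max_sub_max_le_max _ _ _ _).trans
    (max_le (by simp) ((abs_min_sub_min_le_max _ _ _ _).trans (by simp)))

lemma abs_clip_sub_self_le {R : ℝ} (hR : 0 ≤ R) (y : ℝ) : |clip R y - y| ≤ max 0 (|y| - R) := by
  unfold clip
  rcases le_total y R with h1 | h1
  · rw [min_eq_right h1]
    rcases le_total (-R) y with h2 | h2
    · rw [max_eq_right h2]; simp
    · rw [max_eq_left h2, abs_of_nonpos (by linarith : y ≤ 0), abs_of_nonneg (by linarith)]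
      exact le_max_of_le_right (by linarith)
  · rw [min_eq_left h1, max_eq_right (by linarith), abs_of_nonneg (by linarith : 0 ≤ y),
      abs_of_nonpos (by linarith)]
    exact le_max_of_le_right (by linarith)

/-- The bias that clipping at level `R` causes for a Gaussian variable. -/
lemma abs_integral_clip_sub_le {R a θ t : ℝ} (v : NNReal) (hR : 0 ≤ R) (hθ : |θ| + a ≤ R)
    (ht : 0 < t) :
    |∫ e, clip R (θ + e) ∂gaussianReal 0 v - θ| ≤
      2 / t * Real.exp (-(t * a) + v * t ^ 2 / 2) := by
  have hmeas : Measurable fun e => clip R (θ + e) := (measurable_clip R).comp (by fun_prop)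
  have hi : Integrable (fun e => clip R (θ + e)) (gaussianReal 0 v) :=
    Integrable.of_bound hmeas.aestronglyMeasurable R (Filter.Eventually.of_forall fun e => by
      simpa using clip_mem hR (θ + e))
  have hie : Integrable (fun e : ℝ => e) (gaussianReal 0 v) :=
    (memLp_id_gaussianReal 1).integrable le_rfl
  have hid : Integrable (fun e : ℝ => θ + e) (gaussianReal 0 v) := (integrable_const θ).add hie
  have h1 : ∫ e, (θ + e) ∂gaussianReal 0 v = θ := by
    rw [integral_add (integrable_const θ) hie]
    simp
  have h2 : ∫ e, clip R (θ + e) ∂gaussianReal 0 v - θ =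
      ∫ e, (clip R (θ + e) - (θ + e)) ∂gaussianReal 0 v := by
    rw [integral_sub hi hid, h1]
  have hexp : ∀ u : ℝ, ∫ e, Real.exp (u * e) ∂gaussianReal 0 v = Real.exp (v * u ^ 2 / 2) :=
    fun u => by
      have := mgf_gaussianReal (p := gaussianReal 0 v) (X := id) (μ := 0) (v := v) (by simp) u
      simpa [mgf] using this
  -- Chernoff majorant: `|θ + e| - R ≤ |e| - a ≤ t⁻¹ e^{t(|e| - a)}` and `e^{t|e|} ≤ e^{te} +
  -- e^{-te}`, so two values of the moment generating function suffice.
  have hmaj : Integrable (fun e => 1 / t * Real.exp (-(t * a)) *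
      (Real.exp (t * e) + Real.exp (-t * e))) (gaussianReal 0 v) :=
    ((integrable_exp_mul_gaussianReal t).add (integrable_exp_mul_gaussianReal (-t))).const_mul _
  rw [h2, ← Real.norm_eq_abs]
  refine (norm_integral_le_of_norm_le hmaj (Filter.Eventually.of_forall fun e => ?_)).trans
    (le_of_eq ?_)
  · rw [Real.norm_eq_abs]
    refine (abs_clip_sub_self_le hR _).trans (max_le (by positivity) ?_)
    have h3 : |θ + e| - R ≤ |e| - a := by linarith [abs_add_le θ e]
    have h4 : t * (|e| - a) ≤ Real.exp (t * (|e| - a)) := by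
      linarith [Real.add_one_le_exp (t * (|e| - a))]
    have h5 : Real.exp (t * |e|) ≤ Real.exp (t * e) + Real.exp (-t * e) := by
      rcases abs_cases e with ⟨he, -⟩ | ⟨he, -⟩ <;> rw [he]
      · linarith [Real.exp_pos (-t * e)]
      · rw [mul_neg, neg_mul]
        linarith [Real.exp_pos (t * e)]
    calc |θ + e| - R ≤ 1 / t * (t * (|e| - a)) := by field_simp; linarith
      _ ≤ 1 / t * Real.exp (t * (|e| - a)) := by gcongr
      _ = 1 / t * Real.exp (-(t * a)) * Real.exp (t * |e|) := by
          rw [mul_assoc, ← Real.exp_add]; congr 2; ring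
      _ ≤ _ := by gcongr
  · rw [integral_const_mul, integral_add (integrable_exp_mul_gaussianReal t)
      (integrable_exp_mul_gaussianReal (-t)), hexp, hexp, neg_sq, Real.exp_add]
    ring

/-- At level `Cf (1 + 4 √(log n))` the clipping bias is `O(1 / n)`. -/
lemma abs_integral_clip_sub_le_div {Cf R θ σe : ℝ} {n : ℕ} (hn : 2 ≤ n) (hσe : 0 ≤ σe)
    (hσe' : σe ≤ Cf) (hθ : |θ| ≤ Cf) (hR : Cf * (1 + 4 * Real.sqrt (Real.log n)) ≤ R) :
    |∫ e, clip R (θ + e) ∂gaussianReal 0 (σe ^ 2).toNNReal - θ| ≤ (Cf + 2) / n := by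
  have hn0 : (0 : ℝ) < n := by positivity
  have hn2 : (2 : ℝ) ≤ n := by exact_mod_cast hn
  have hCf : 0 ≤ Cf := hσe.trans hσe'
  have hL : Real.log 2 ≤ Real.log n := Real.log_le_log (by norm_num) hn2
  have hL2 := Real.log_two_gt_d9
  set q : ℝ := Real.sqrt (Real.log n) with hq
  have hqq : q ^ 2 = Real.log n := Real.sq_sqrt (by linarith)
  have hq1 : 1 / 2 ≤ q := Real.le_sqrt_of_sq_le (by norm_num; linarith)
  have hR0 : 0 ≤ R := le_trans (by positivity) hR
  have hv : ((σe ^ 2).toNNReal : ℝ) = σe ^ 2 := Real.coe_toNNReal _ (sq_nonneg _)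
  have hθa : |θ| + 4 * Cf * q ≤ R := by nlinarith
  rcases hCf.eq_or_lt with h0 | h0
  -- Without noise the margin `a` is zero and every `t` is allowed; `t = n` gives `2/n`, the reason
  -- for the summand `2` in the bound.
  · have hs0 : σe = 0 := by linarith
    refine (abs_integral_clip_sub_le (σe ^ 2).toNNReal hR0 hθa hn0).trans (le_of_eq ?_)
    rw [hv, hs0, ← h0]
    simp
  -- For `σe = Cf` this `t` minimises `-ta + σe² t²/2` at `a = 4 Cf q`. The exponent is then at most
  -- `-16 q² + 8 q² = -8 log n`, more than enough for `1/n`.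
  · refine (abs_integral_clip_sub_le (σe ^ 2).toNNReal hR0 hθa
      (t := 4 * q / Cf) (by positivity)).trans ?_
    rw [hv]
    have h1 : -(4 * q / Cf * (4 * Cf * q)) + σe ^ 2 * (4 * q / Cf) ^ 2 / 2 ≤ -Real.log n := by
      have h2 : σe ^ 2 * (4 * q / Cf) ^ 2 / 2 ≤ Cf ^ 2 * (4 * q / Cf) ^ 2 / 2 := by gcongr
      have h3 : Cf ^ 2 * (4 * q / Cf) ^ 2 / 2 = 8 * q ^ 2 := by field_simp; ring
      have h4 : 4 * q / Cf * (4 * Cf * q) = 16 * q ^ 2 := by field_simp; ring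
      nlinarith [sq_nonneg q]
    have h5 : Real.exp (-(4 * q / Cf * (4 * Cf * q)) + σe ^ 2 * (4 * q / Cf) ^ 2 / 2) ≤ 1 / n := by
      refine (Real.exp_le_exp.2 h1).trans (le_of_eq ?_)
      rw [Real.exp_neg, Real.exp_log hn0, one_div]
    have h6 : 2 / (4 * q / Cf) ≤ Cf + 2 := by
      rw [div_div_eq_mul_div, div_le_iff₀ (by positivity)]
      nlinarith
    calc _ ≤ (Cf + 2) * (1 / n) := by gcongr
      _ = _ := by ring

/-! ### The observation law and the mean squares of degree and numerator -/

lemma isProbabilityMeasure_obsLaw {d : ℕ} {μ f : Space d → ℝ} (hf : Measurable f)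
    (hP : IsProbabilityMeasure (designLaw μ)) (σe : ℝ) : IsProbabilityMeasure (obsLaw μ f σe) := by
  unfold obsLaw
  exact Measure.isProbabilityMeasure_map (by fun_prop)

namespace IsRegressionModel

variable {d s : ℕ} {Cf Lf Lμ r₀ σe : ℝ} {M : Set (Space d)} {μ f : Space d → ℝ} {x₀ : Space d}

lemma map_fst_obsLaw (h : IsRegressionModel s Cf Lf Lμ r₀ M μ f σe x₀) :
    MeasurePreserving Prod.fst (obsLaw μ f σe) (designLaw μ) := by
  have := h.design_prob
  have hf := h.f_measurable
  refine ⟨measurable_fst, ?_⟩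
  rw [obsLaw, Measure.map_map measurable_fst (by fun_prop)]
  exact (measurePreserving_fst (μ := designLaw μ)
    (ν := gaussianReal 0 (σe ^ 2).toNNReal)).map_eq

lemma ae_fst_mem (h : IsRegressionModel s Cf Lf Lμ r₀ M μ f σe x₀) :
    ∀ᵐ z ∂obsLaw μ f σe, z.1 ∈ M :=
  h.map_fst_obsLaw.quasiMeasurePreserving.ae h.ae_mem

lemma integral_fst_obsLaw (h : IsRegressionModel s Cf Lf Lμ r₀ M μ f σe x₀) {g : Space d → ℝ}
    (hg : Measurable g) : ∫ z, g z.1 ∂obsLaw μ f σe = ∫ x, g x ∂designLaw μ := by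
  rw [← h.map_fst_obsLaw.map_eq, integral_map measurable_fst.aemeasurable hg.aestronglyMeasurable]

lemma integral_obsLaw (h : IsRegressionModel s Cf Lf Lμ r₀ M μ f σe x₀) {g : Space d × ℝ → ℝ}
    (hg : Measurable g) (hgi : Integrable g (obsLaw μ f σe)) :
    ∫ z, g z ∂obsLaw μ f σe =
      ∫ x, ∫ e, g (x, f x + e) ∂gaussianReal 0 (σe ^ 2).toNNReal ∂designLaw μ := by
  have := h.design_prob
  have hf := h.f_measurable
  have hm : Measurable fun p : Space d × ℝ => (p.1, f p.1 + p.2) := by fun_prop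
  rw [obsLaw, integral_map hm.aemeasurable hg.aestronglyMeasurable, integral_prod]
  exact (integrable_map_measure hg.aestronglyMeasurable hm.aemeasurable).1 hgi

/-- One kernel factor is bounded by its supremum, of order `σ^{-d}`, and the other is kept in mean.
This yields a variance of order `σ^{-d}` instead of `σ^{-2d}`. -/
lemma integral_sq_scaledKernel_mul_le (h : IsRegressionModel s Cf Lf Lμ r₀ M μ f σe x₀) {CK : ℝ}
    {K : ℝ → ℝ} (hK : IsRegularKernel d s CK K) {σ : ℝ} (hσ : 0 < σ) {g : Space d × ℝ → ℝ} {H : ℝ}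
    (hH : ∀ z, z.1 ∈ M → |g z| ≤ H) :
    ∫ z, (scaledKernel K σ x₀ z.1 * g z) ^ 2 ∂obsLaw μ f σe ≤
      H ^ 2 * (1 / σ ^ d * CK) * ∫ x, |scaledKernel K σ x₀ x| ∂designLaw μ := by
  have := isProbabilityMeasure_obsLaw h.f_measurable h.design_prob σe
  have hKm := measurable_scaledKernel hK.measurable σ x₀
  have hCK := hK.const_pos
  rw [← h.integral_fst_obsLaw (g := fun x => |scaledKernel K σ x₀ x|) hKm.abs,
    ← integral_const_mul]
  refine integral_mono_of_nonneg (Filter.Eventually.of_forall fun z => sq_nonneg _) ?_ ?_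
  · refine Integrable.const_mul (Integrable.of_bound
      (hKm.comp measurable_fst).abs.aestronglyMeasurable (1 / σ ^ d * CK)
      (Filter.Eventually.of_forall fun z => ?_)) _
    simpa using hK.abs_scaledKernel_le hσ x₀ z.1
  · filter_upwards [h.ae_fst_mem] with z hz
    have h1 := hK.abs_scaledKernel_le hσ x₀ z.1
    have h2 : g z ^ 2 ≤ H ^ 2 := sq_le_sq' (abs_le.1 (hH z hz)).1 (abs_le.1 (hH z hz)).2
    calc (scaledKernel K σ x₀ z.1 * g z) ^ 2
        = g z ^ 2 * (|scaledKernel K σ x₀ z.1| * |scaledKernel K σ x₀ z.1|) := by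
          rw [abs_mul_abs_self]; ring
      _ ≤ H ^ 2 * ((1 / σ ^ d * CK) * |scaledKernel K σ x₀ z.1|) := by gcongr
      _ = _ := by ring

end IsRegressionModel

/-- Mean square deviation of the degree function from `n μ(x₀)`. -/
lemma exists_degree_moment {d s : ℕ} (hd : 1 ≤ d) (hs : 1 ≤ s) (Cf Lf Lμ : ℝ) {r₀ CK : ℝ}
    (hr₀ : 0 < r₀) (hCK : 0 < CK) :
    ∃ C : ℝ, 0 ≤ C ∧ ∀ (M : Set (Space d)) (μ f : Space d → ℝ) (σe : ℝ) (x₀ : Space d)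
      (K : ℝ → ℝ) (σ : ℝ) (n : ℕ), IsRegressionModel s Cf Lf Lμ r₀ M μ f σe x₀ →
      IsRegularKernel d s CK K → 0 < σ → σ ≤ 1 →
      Integrable (fun z => (degree K σ x₀ z - n * μ x₀) ^ 2) (sampleLaw n μ f σe) ∧
      ∫ z, (degree K σ x₀ z - n * μ x₀) ^ 2 ∂sampleLaw n μ f σe ≤
        C * (n * (1 / σ ^ d) + (n * σ ^ s) ^ 2) := by
  obtain ⟨Cb, hCb, Hb⟩ := exists_degree_bias hd hs Cf Lf Lμ hr₀ hCK
  obtain ⟨Ca, hCa, Ha⟩ := exists_abs_kernel_bound hd hs Cf Lf Lμ hr₀ hCK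
  obtain ⟨Cm, hCm, Hm⟩ := exists_density_bound d s hs Cf Lf Lμ hr₀
  -- A variance constant plus a squared-bias constant; nonnegative cross terms are added at the end
  -- so that their sum factors out.
  refine ⟨(2 * (CK * Ca) + 2 * Cm ^ 2) + Cb ^ 2, by positivity, ?_⟩
  intro M μ f σe x₀ K σ n h hK hσ hσ1
  have hprob := isProbabilityMeasure_obsLaw h.f_measurable h.design_prob σe
  have hKm := measurable_scaledKernel hK.measurable σ x₀
  have hdeg : ∀ z : Fin n → Space d × ℝ,
      degree K σ x₀ z - n * μ x₀ = ∑ i, (scaledKernel K σ x₀ (z i).1 - μ x₀) := fun z => by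
    simp [degree]
  have hKi : MemLp (fun z : Space d × ℝ => scaledKernel K σ x₀ z.1) 2 (obsLaw μ f σe) :=
    MemLp.of_bound (hKm.comp measurable_fst).aestronglyMeasurable (1 / σ ^ d * CK)
      (Filter.Eventually.of_forall fun z => hK.abs_scaledKernel_le hσ x₀ z.1)
  have hg : MemLp (fun z : Space d × ℝ => scaledKernel K σ x₀ z.1 - μ x₀) 2 (obsLaw μ f σe) :=
    hKi.sub (memLp_const _)
  have hμ0 : μ x₀ ≤ Cm := by simpa using Hm M μ f σe x₀ h 0 (Metric.mem_ball_self hr₀)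
  have hσd : 1 ≤ 1 / σ ^ d := (one_le_div (by positivity)).2 (pow_le_one₀ hσ.le hσ1)
  simp only [hdeg]
  refine ⟨(memLp_sum_pi _ hg n).integrable_sq, (integral_sum_sq_pi_le _ hg n).trans ?_⟩
  have h1 : |∫ z, (scaledKernel K σ x₀ z.1 - μ x₀) ∂obsLaw μ f σe| ≤ Cb * σ ^ s := by
    rw [integral_sub (hKi.integrable one_le_two) (integrable_const _),
      h.integral_fst_obsLaw (g := scaledKernel K σ x₀) hKm]
    simpa using Hb M μ f σe x₀ K σ h hK hσ hσ1
  have h2 : ∫ z, (scaledKernel K σ x₀ z.1) ^ 2 ∂obsLaw μ f σe ≤ 1 / σ ^ d * CK * Ca := by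
    have h3 := h.integral_sq_scaledKernel_mul_le hK hσ (g := fun _ => 1) (H := 1) (by simp)
    simp only [mul_one, one_pow, one_mul] at h3
    refine h3.trans (mul_le_mul_of_nonneg_left (Ha M μ f σe x₀ K σ h hK hσ hσ1) (by positivity))
  have h4 : ∫ z, (scaledKernel K σ x₀ z.1 - μ x₀) ^ 2 ∂obsLaw μ f σe ≤
      1 / σ ^ d * (2 * (CK * Ca) + 2 * Cm ^ 2) := by
    calc _ ≤ ∫ z, (2 * (scaledKernel K σ x₀ z.1) ^ 2 + 2 * Cm ^ 2) ∂obsLaw μ f σe := by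
          refine integral_mono hg.integrable_sq
            ((hKi.integrable_sq.const_mul 2).add (integrable_const _)) fun z => ?_
          have h5 : μ x₀ ^ 2 ≤ Cm ^ 2 := pow_le_pow_left₀ (h.density_nonneg _) hμ0 2
          nlinarith [sq_nonneg (scaledKernel K σ x₀ z.1 + μ x₀)]
      _ = 2 * ∫ z, (scaledKernel K σ x₀ z.1) ^ 2 ∂obsLaw μ f σe + 2 * Cm ^ 2 := by
          rw [integral_add (hKi.integrable_sq.const_mul 2) (integrable_const _), integral_const_mul]
          simp
      _ ≤ 2 * (1 / σ ^ d * CK * Ca) + 1 / σ ^ d * (2 * Cm ^ 2) := by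
          exact add_le_add (by gcongr) (le_mul_of_one_le_left (by positivity) hσd)
      _ = _ := by ring
  have h6 : (n * ∫ z, (scaledKernel K σ x₀ z.1 - μ x₀) ∂obsLaw μ f σe) ^ 2 ≤
      Cb ^ 2 * (n * σ ^ s) ^ 2 := by
    rw [← mul_pow, ← sq_abs, abs_mul, Nat.abs_cast]
    refine pow_le_pow_left₀ (by positivity) ?_ 2
    calc _ ≤ n * (Cb * σ ^ s) := by gcongr
      _ = _ := by ring
  have hV0 : 0 ≤ 2 * (CK * Ca) + 2 * Cm ^ 2 := by positivity
  calc _ ≤ n * (1 / σ ^ d * (2 * (CK * Ca) + 2 * Cm ^ 2)) + Cb ^ 2 * (n * σ ^ s) ^ 2 := by gcongr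
    _ ≤ n * (1 / σ ^ d * (2 * (CK * Ca) + 2 * Cm ^ 2)) + Cb ^ 2 * (n * σ ^ s) ^ 2 +
          (Cb ^ 2 * (n * (1 / σ ^ d)) + (2 * (CK * Ca) + 2 * Cm ^ 2) * (n * σ ^ s) ^ 2) :=
        le_add_of_nonneg_right (by positivity)
    _ = _ := by ring

/-- Mean square of the centred numerator of the Nadaraya-Watson estimator with clipped
responses. -/
lemma exists_numerator_moment {d s : ℕ} (hd : 1 ≤ d) (hs : 1 ≤ s) (Cf Lf Lμ : ℝ) {r₀ CK : ℝ}
    (hr₀ : 0 < r₀) (hCK : 0 < CK) :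
    ∃ C : ℝ, 0 ≤ C ∧ ∀ (M : Set (Space d)) (μ f : Space d → ℝ) (σe : ℝ) (x₀ : Space d)
      (K : ℝ → ℝ) (σ R : ℝ) (n : ℕ), IsRegressionModel s Cf Lf Lμ r₀ M μ f σe x₀ →
      IsRegularKernel d s CK K → 0 < σ → σ ≤ 1 → 2 ≤ n → 1 / n ≤ σ ^ s →
      Cf * (1 + 4 * Real.sqrt (Real.log n)) ≤ R →
      Integrable (fun z => (∑ i, scaledKernel K σ x₀ (z i).1 * (clip R (z i).2 - f x₀)) ^ 2)
        (sampleLaw n μ f σe) ∧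
      ∫ z, (∑ i, scaledKernel K σ x₀ (z i).1 * (clip R (z i).2 - f x₀)) ^ 2 ∂sampleLaw n μ f σe ≤
        C * (R ^ 2 * (n * (1 / σ ^ d)) + (n * σ ^ s) ^ 2) := by
  obtain ⟨Cb, hCb, Hb⟩ := exists_degree_bias hd hs Cf Lf Lμ hr₀ hCK
  obtain ⟨Cn, hCn, Hn⟩ := exists_numerator_bias hd hs Cf Lf Lμ hr₀ hCK
  obtain ⟨Ca, hCa, Ha⟩ := exists_abs_kernel_bound hd hs Cf Lf Lμ hr₀ hCK
  -- Three sources of bias: smoothing `fμ`, smoothing `μ` with weight `f x₀`, and clipping, where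
  -- `1/n ≤ σ^s`. The limits of the first two are both `f x₀ * μ x₀` and cancel.
  set E : ℝ := Cn + |Cf| * Cb + (|Cf| + 2) * Ca with hE
  refine ⟨4 * (CK * Ca) + E ^ 2, by positivity, ?_⟩
  intro M μ f σe x₀ K σ R n h hK hσ hσ1 hn hnσ hR
  have hprob := isProbabilityMeasure_obsLaw h.f_measurable h.design_prob σe
  have hprob' := h.design_prob
  have hf := h.f_measurable
  have hKm := measurable_scaledKernel hK.measurable σ x₀
  have hCf := h.noise_const_nonneg
  have hf0 : |f x₀| ≤ Cf := h.f_bound x₀ (h.interior (Metric.mem_ball_self hr₀))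
  have hCR : Cf ≤ R := le_trans (by nlinarith [Real.sqrt_nonneg (Real.log n)]) hR
  have hR0 : 0 ≤ R := hCf.trans hCR
  have hclip : ∀ y, |clip R y - f x₀| ≤ 2 * R := fun y =>
    (abs_sub _ _).trans (by linarith [clip_mem hR0 y])
  set g : Space d × ℝ → ℝ := fun z => scaledKernel K σ x₀ z.1 * (clip R z.2 - f x₀) with hgdef
  have hgm : Measurable g := (hKm.comp measurable_fst).mul
    (((measurable_clip R).comp measurable_snd).sub_const _)
  have hg : MemLp g 2 (obsLaw μ f σe) :=
    MemLp.of_bound hgm.aestronglyMeasurable (1 / σ ^ d * CK * (2 * R))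
      (Filter.Eventually.of_forall fun z => by
        rw [Real.norm_eq_abs, abs_mul]
        exact mul_le_mul (hK.abs_scaledKernel_le hσ x₀ z.1) (hclip _) (abs_nonneg _)
          (by positivity))
  refine ⟨(memLp_sum_pi _ hg n).integrable_sq, (integral_sum_sq_pi_le _ hg n).trans ?_⟩
  have h2 : ∫ z, g z ^ 2 ∂obsLaw μ f σe ≤ (2 * R) ^ 2 * (1 / σ ^ d * CK) * Ca :=
    (h.integral_sq_scaledKernel_mul_le hK hσ (g := fun z => clip R z.2 - f x₀)
      fun z _ => hclip z.2).trans
      (mul_le_mul_of_nonneg_left (Ha M μ f σe x₀ K σ h hK hσ hσ1) (by positivity))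
  have h1 : |∫ z, g z ∂obsLaw μ f σe| ≤ E * σ ^ s := by
    set N := gaussianReal 0 (σe ^ 2).toNNReal with hN
    set m : Space d → ℝ := fun x => ∫ e, clip R (f x + e) ∂N with hm
    have hcm : ∀ x, Integrable (fun e => clip R (f x + e)) N := fun x =>
      Integrable.of_bound ((measurable_clip R).comp (by fun_prop)).aestronglyMeasurable R
        (Filter.Eventually.of_forall fun e => clip_mem hR0 _)
    have hmm : Measurable m := by
      have h3 : Measurable fun p : Space d × ℝ => clip R (f p.1 + p.2) :=
        (measurable_clip R).comp (by fun_prop)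
      exact h3.stronglyMeasurable.integral_prod_right'.measurable
    have hmf : ∀ x ∈ M, |m x - f x| ≤ (Cf + 2) / n := fun x hx =>
      abs_integral_clip_sub_le_div hn h.noise_nonneg h.noise_bound (h.f_bound x hx) hR
    have hKf := h.integrable_scaledKernel_mul hK hσ hf Cf h.f_bound
    have hKmf : Integrable (fun x => scaledKernel K σ x₀ x * (m x - f x)) (designLaw μ) :=
      h.integrable_scaledKernel_mul hK hσ (hmm.sub hf) _ hmf
    have hKi : Integrable (scaledKernel K σ x₀) (designLaw μ) :=
      h.integrable_of_bound hKm _ fun x _ => hK.abs_scaledKernel_le hσ x₀ x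
    have hKs : Integrable (fun x => scaledKernel K σ x₀ x * f x - f x₀ * scaledKernel K σ x₀ x)
        (designLaw μ) := hKf.sub (hKi.const_mul _)
    have h4 : ∫ z, g z ∂obsLaw μ f σe =
        (∫ x, scaledKernel K σ x₀ x * f x ∂designLaw μ - f x₀ * μ x₀) -
        f x₀ * (∫ x, scaledKernel K σ x₀ x ∂designLaw μ - μ x₀) +
        ∫ x, scaledKernel K σ x₀ x * (m x - f x) ∂designLaw μ := by
      rw [h.integral_obsLaw hgm (hg.integrable one_le_two)]
      calc _ = ∫ x, (scaledKernel K σ x₀ x * f x - f x₀ * scaledKernel K σ x₀ x +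
            scaledKernel K σ x₀ x * (m x - f x)) ∂designLaw μ := by
            refine integral_congr_ae (Filter.Eventually.of_forall fun x => ?_)
            simp only [hgdef]
            rw [integral_const_mul, integral_sub (hcm x) (integrable_const _)]
            simp only [integral_const, probReal_univ, smul_eq_mul, one_mul, hm]
            ring
        _ = _ := by
            rw [integral_add hKs hKmf,
              integral_sub hKf (hKi.const_mul _), integral_const_mul]
            ring
    have h5 : |∫ x, scaledKernel K σ x₀ x * (m x - f x) ∂designLaw μ| ≤
        (|Cf| + 2) * Ca * σ ^ s := by
      rw [← Real.norm_eq_abs]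
      refine (norm_integral_le_of_norm_le (hKi.abs.mul_const ((Cf + 2) / n)) ?_).trans ?_
      · filter_upwards [h.ae_mem] with x hx
        rw [Real.norm_eq_abs, abs_mul]
        exact mul_le_mul_of_nonneg_left (hmf x hx) (abs_nonneg _)
      · rw [integral_mul_const, abs_of_nonneg hCf]
        calc _ ≤ Ca * ((Cf + 2) * σ ^ s) := by
              refine mul_le_mul (Ha M μ f σe x₀ K σ h hK hσ hσ1) ?_ (by positivity) hCa
              rw [div_eq_mul_one_div]
              gcongr
          _ = _ := by ring
    rw [h4, hE]
    have h6 := Hn M μ f σe x₀ K σ h hK hσ hσ1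
    have h7 : |f x₀ * (∫ x, scaledKernel K σ x₀ x ∂designLaw μ - μ x₀)| ≤
        |Cf| * (Cb * σ ^ s) := by
      rw [abs_mul]
      exact mul_le_mul (hf0.trans (le_abs_self _)) (Hb M μ f σe x₀ K σ h hK hσ hσ1)
        (abs_nonneg _) (abs_nonneg _)
    refine (abs_add_le _ _).trans ((add_le_add ((abs_sub _ _).trans (add_le_add h6 h7)) h5).trans
      (le_of_eq (by ring)))
  have h6 : (n * ∫ z, g z ∂obsLaw μ f σe) ^ 2 ≤ E ^ 2 * (n * σ ^ s) ^ 2 := by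
    rw [← mul_pow, ← sq_abs, abs_mul, Nat.abs_cast]
    refine pow_le_pow_left₀ (by positivity) ?_ 2
    calc _ ≤ n * (E * σ ^ s) := by gcongr
      _ = _ := by ring
  calc _ ≤ n * ((2 * R) ^ 2 * (1 / σ ^ d * CK) * Ca) + E ^ 2 * (n * σ ^ s) ^ 2 := by gcongr
    _ ≤ n * ((2 * R) ^ 2 * (1 / σ ^ d * CK) * Ca) + E ^ 2 * (n * σ ^ s) ^ 2 +
          (E ^ 2 * (R ^ 2 * (n * (1 / σ ^ d))) + 4 * (CK * Ca) * (n * σ ^ s) ^ 2) :=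
        le_add_of_nonneg_right (by positivity)
    _ = _ := by ring

/-! ### Release probability, conditional loss and risk -/

lemma releaseProb_nonneg (ε δ γ : ℝ) : 0 ≤ releaseProb ε δ γ := by
  unfold releaseProb; positivity

lemma one_sub_releaseProb (ε δ γ : ℝ) :
    1 - releaseProb ε δ γ = 1 / (Real.exp (1 / 2 * ε * (γ - threshold ε δ)) + 1) := by
  unfold releaseProb
  have := Real.exp_pos (1 / 2 * ε * (γ - threshold ε δ))
  field_simp
  ring

lemma one_sub_releaseProb_nonneg (ε δ γ : ℝ) : 0 ≤ 1 - releaseProb ε δ γ := by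
  rw [one_sub_releaseProb]; positivity

/-- Here half of `ε (γ - threshold)` equals `εγ/2 - ε/2 - log(1/δ)`. One quarter of `εγ` absorbs
`ε/2` because `γ ≥ 2`; the other is at least `2 log(1/δ)`, leaving `log(1/δ)`. -/
lemma one_sub_releaseProb_le {ε δ γ : ℝ} (hε : 0 < ε) (hδ : 0 < δ) (hγ : 2 ≤ γ)
    (hmax : 1 / ε ≤ 1 / δ) (h : 8 * Real.log (1 / δ) ≤ ε * γ) : 1 - releaseProb ε δ γ ≤ δ := by
  rw [one_sub_releaseProb, one_div, inv_le_comm₀ (by positivity) hδ]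
  have h1 : Real.log (1 / δ) ≤ 1 / 2 * ε * (γ - threshold ε δ) := by
    rw [threshold, max_eq_left hmax]
    have h2 : 1 / 2 * ε * (γ - (1 + 2 / ε * Real.log (1 / δ))) =
        1 / 2 * (ε * γ) - ε / 2 - Real.log (1 / δ) := by
      field_simp
      ring
    rw [h2]
    nlinarith
  have h3 := Real.exp_le_exp.2 h1
  rw [Real.exp_log (by positivity), one_div] at h3
  linarith

lemma lintegral_sq_gaussian_affine (c b : ℝ) :
    ∫⁻ ζ, ENNReal.ofReal ((c + b * ζ) ^ 2) ∂gaussianReal 0 1 = ENNReal.ofReal (c ^ 2 + b ^ 2) := by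
  have hm : MemLp (fun ζ : ℝ => ζ) 2 (gaussianReal 0 1) := memLp_id_gaussianReal 2
  have hi : Integrable (fun ζ : ℝ => ζ) (gaussianReal 0 1) := hm.integrable one_le_two
  have h1 : ∫ ζ, ζ ^ 2 ∂gaussianReal 0 1 = 1 := by
    have h2 := variance_eq_sub hm
    rw [variance_fun_id_gaussianReal, integral_id_gaussianReal] at h2
    simpa using h2.symm
  have hI' : Integrable (fun ζ : ℝ => c ^ 2 + 2 * c * b * ζ) (gaussianReal 0 1) :=
    (integrable_const _).add (hi.const_mul _)
  have hI : Integrable (fun ζ : ℝ => c ^ 2 + 2 * c * b * ζ + b ^ 2 * ζ ^ 2) (gaussianReal 0 1) :=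
    hI'.add (hm.integrable_sq.const_mul _)
  have heq : ∀ ζ : ℝ, (c + b * ζ) ^ 2 = c ^ 2 + 2 * c * b * ζ + b ^ 2 * ζ ^ 2 := fun ζ => by ring
  rw [lintegral_congr fun ζ => by rw [heq ζ], ← ofReal_integral_eq_lintegral_ofReal hI
    (Filter.Eventually.of_forall fun ζ => by
      simp only [← heq]
      exact sq_nonneg _),
    integral_add hI' (hm.integrable_sq.const_mul _),
    integral_add (integrable_const _) (hi.const_mul _), integral_const_mul, integral_const_mul,
    h1, integral_id_gaussianReal]
  simp

/-- The mean square error of efficient propose-test-release given the data. -/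
lemma lintegral_eptrLaw_le {ε δ α Cbot est γ θ : ℝ} {bot : Measure ℝ} [IsProbabilityMeasure bot]
    (hbot : ∀ᵐ t ∂bot, (t - θ) ^ 2 ≤ Cbot) (hCbot : 0 ≤ Cbot) (hδ : 0 < δ) (hδ1 : δ ≤ 1) :
    ∫⁻ t, ENNReal.ofReal ((t - θ) ^ 2) ∂eptrLaw ε δ α bot est γ ≤
      ENNReal.ofReal ((1 - releaseProb ε δ γ) * Cbot + (est - θ) ^ 2 +
        (2 * α / ε) ^ 2 * (2 * Real.log (1.25 / δ))) := by
  set b : ℝ := 2 * α / ε * Real.sqrt (2 * Real.log (1.25 / δ)) with hb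
  have hlog : 0 ≤ Real.log (1.25 / δ) :=
    Real.log_nonneg ((one_le_div hδ).2 (hδ1.trans (by norm_num)))
  have hb2 : b ^ 2 = (2 * α / ε) ^ 2 * (2 * Real.log (1.25 / δ)) := by
    rw [hb, mul_pow, Real.sq_sqrt (by positivity)]
  have hm : Measurable fun t : ℝ => ENNReal.ofReal ((t - θ) ^ 2) := by fun_prop
  have h1 : ∫⁻ t, ENNReal.ofReal ((t - θ) ^ 2) ∂bot ≤ ENNReal.ofReal Cbot := by
    refine (lintegral_mono_ae (hbot.mono fun t ht => ENNReal.ofReal_le_ofReal ht)).trans ?_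
    simp
  have h2 : ∫⁻ t, ENNReal.ofReal ((t - θ) ^ 2) ∂((gaussianReal 0 1).map fun ζ => est + b * ζ) =
      ENNReal.ofReal ((est - θ) ^ 2 + b ^ 2) := by
    rw [lintegral_map hm (by fun_prop), ← lintegral_sq_gaussian_affine]
    refine lintegral_congr fun ζ => ?_
    ring_nf
  rw [← hb2, eptrLaw, lintegral_add_measure, lintegral_smul_measure, lintegral_smul_measure, h2,
    smul_eq_mul, smul_eq_mul, add_assoc, ENNReal.ofReal_add
      (mul_nonneg (one_sub_releaseProb_nonneg _ _ _) hCbot) (by positivity),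
    ENNReal.ofReal_mul (one_sub_releaseProb_nonneg _ _ _)]
  refine add_le_add (mul_le_mul_right h1 _) (mul_le_of_le_one_left zero_le ?_)
  exact ENNReal.ofReal_le_one.2 (by linarith [one_sub_releaseProb_nonneg ε δ γ])

lemma nwEstimator_sub_sq_le {d n : ℕ} {K : ℝ → ℝ} {σ R θ : ℝ} (hR : |θ| ≤ R) (x₀ : Space d)
    (w : Fin n → Space d × ℝ) : (nwEstimator K σ R x₀ w - θ) ^ 2 ≤ 4 * R ^ 2 := by
  have hR0 : 0 ≤ R := (abs_nonneg _).trans hR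
  have h0 : |nwEstimator K σ R x₀ w| ≤ R := clip_mem hR0 _
  have h1 : |nwEstimator K σ R x₀ w - θ| ≤ 2 * R := (abs_sub _ _).trans (by linarith)
  rw [← sq_abs]
  nlinarith [abs_nonneg (nwEstimator K σ R x₀ w - θ)]

/-- The weights sum to the degree, so `θ` can be subtracted inside the quotient, and clipping does
not increase the error. The weights may be negative; only the lower bound on their sum matters. -/
lemma nwEstimator_sub_sq_le_of_degree {d n : ℕ} {K : ℝ → ℝ} {σ R θ D : ℝ} (hR : |θ| ≤ R)
    (x₀ : Space d) (w : Fin n → Space d × ℝ) (hD : 0 < D) (hDw : D ≤ degree K σ x₀ w) :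
    (nwEstimator K σ R x₀ w - θ) ^ 2 ≤
      (∑ i, scaledKernel K σ x₀ (w i).1 * ((w i).2 - θ)) ^ 2 / D ^ 2 := by
  have hpos : 0 < degree K σ x₀ w := hD.trans_le hDw
  have h1 : (∑ i, scaledKernel K σ x₀ (w i).1 * (w i).2) / degree K σ x₀ w - θ =
      (∑ i, scaledKernel K σ x₀ (w i).1 * ((w i).2 - θ)) / degree K σ x₀ w := by
    rw [eq_div_iff hpos.ne', sub_mul, div_mul_cancel₀ _ hpos.ne']
    simp only [mul_sub, Finset.sum_sub_distrib, ← Finset.sum_mul]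
    rw [mul_comm θ]
    rfl
  have h2 := abs_clip_sub_le (R := R) ((∑ i, scaledKernel K σ x₀ (w i).1 * (w i).2) /
    degree K σ x₀ w) hR
  rw [h1] at h2
  refine (sq_le_sq.2 h2).trans ?_
  rw [div_pow]
  gcongr

/-- On the event that the degree is not too small the sub-distance is large. -/
lemma le_nwGamma {d n : ℕ} {K : ℝ → ℝ} {CK σ c₀ m : ℝ} (hCK : 0 < CK) (hσ : 0 < σ) (hn : 0 < n)
    (hc₀ : 0 < c₀) (hm : 2 * c₀ + 4 / ((n : ℝ) * σ ^ d) * CK < m) (x₀ : Space d)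
    (w : Fin n → Space d × ℝ) (hw : 3 / 4 * (n * m) ≤ degree K σ x₀ w) :
    n * σ ^ d * c₀ / (4 * CK) ≤ nwGamma K CK σ c₀ x₀ w := by
  have hn' : (0 : ℝ) < n := by exact_mod_cast hn
  have h1 : n * (2 * c₀ + 4 / ((n : ℝ) * σ ^ d) * CK) = 2 * (c₀ * n) + 4 * (1 / σ ^ d) * CK := by
    field_simp
  have h2 := mul_lt_mul_of_pos_left hm hn'
  rw [h1] at h2
  have h3 : 2 * (c₀ * n) ≤ n * m := by
    have : 0 ≤ 4 * (1 / σ ^ d) * CK := by positivity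
    linarith
  -- The lower bound on `m` makes the subtracted terms at most `nm/2`, so at least `nm/4 ≥ c₀ n/2`
  -- is left of `3nm/4`.
  have h4 : c₀ * n / 2 ≤ max 0 (degree K σ x₀ w - c₀ * n - 2 * (1 / σ ^ d) * CK) :=
    le_max_of_le_right (by linarith)
  calc n * σ ^ d * c₀ / (4 * CK) = 1 / (2 * (1 / σ ^ d) * CK) * (c₀ * n / 2) := by
        field_simp
        ring
    _ ≤ _ := by
        unfold nwGamma
        gcongr

/-- The loss of the procedure given the data, in the regime in which the test is passed with high
probability. -/
lemma loss_le {d n : ℕ} {K : ℝ → ℝ} {CK σ c₀ m R θ ε δ Cbot : ℝ} (hCK : 0 < CK) (hσ : 0 < σ)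
    (hn : 0 < n) (hc₀ : 0 < c₀) (hm : 2 * c₀ + 4 / ((n : ℝ) * σ ^ d) * CK < m) (hR : |θ| ≤ R)
    (hε : 0 < ε) (hδ : 0 < δ) (hmax : 1 / ε ≤ 1 / δ) (hCbot : 0 ≤ Cbot)
    (hS : 8 * CK ≤ n * σ ^ d * c₀)
    (hSε : 32 * CK * Real.log (1 / δ) ≤ ε * (n * σ ^ d * c₀)) (x₀ : Space d)
    (w : Fin n → Space d × ℝ) :
    (1 - releaseProb ε δ (nwGamma K CK σ c₀ x₀ w)) * Cbot + (nwEstimator K σ R x₀ w - θ) ^ 2 ≤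
      δ * Cbot + (∑ i, scaledKernel K σ x₀ (w i).1 * ((w i).2 - θ)) ^ 2 / (c₀ * n) ^ 2 +
        (Cbot + 4 * R ^ 2) * (4 * (degree K σ x₀ w - n * m) ^ 2 / (c₀ * n) ^ 2) := by
  have hn' : (0 : ℝ) < n := by exact_mod_cast hn
  have hmc : 2 * c₀ ≤ m := by
    have : 0 ≤ 4 / ((n : ℝ) * σ ^ d) * CK := by positivity
    linarith
  have hnm : 2 * (c₀ * n) ≤ n * m := by nlinarith
  rcases le_total (3 / 4 * (n * m)) (degree K σ x₀ w) with hg | hb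
  · have hγ := le_nwGamma hCK hσ hn hc₀ hm x₀ w hg
    have hγ2 : 2 ≤ nwGamma K CK σ c₀ x₀ w := by
      refine le_trans ?_ hγ
      rw [le_div_iff₀ (by positivity)]
      linarith
    have hγε : 8 * Real.log (1 / δ) ≤ ε * nwGamma K CK σ c₀ x₀ w := by
      refine le_trans ?_ (mul_le_mul_of_nonneg_left hγ hε.le)
      rw [← mul_div_assoc, le_div_iff₀ (by positivity)]
      linarith
    have h1 := one_sub_releaseProb_le hε hδ hγ2 hmax hγε
    have hcn : 0 < c₀ * n := by positivity
    have h2 := nwEstimator_sub_sq_le_of_degree (K := K) (σ := σ) hR x₀ w hcn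
      (by linarith : c₀ * n ≤ degree K σ x₀ w)
    have h3 : 0 ≤ (Cbot + 4 * R ^ 2) * (4 * (degree K σ x₀ w - n * m) ^ 2 / (c₀ * n) ^ 2) := by
      positivity
    have h4 := mul_le_mul_of_nonneg_right h1 hCbot
    linarith
  -- Pointwise Chebyshev: here `nm - degree ≥ nm/4 ≥ c₀ n/2`, so the last factor is at least `1` and
  -- its coefficient covers the trivial loss.
  · have h1 : (1 - releaseProb ε δ (nwGamma K CK σ c₀ x₀ w)) * Cbot ≤ Cbot :=
      mul_le_of_le_one_left hCbot (by linarith [releaseProb_nonneg ε δ (nwGamma K CK σ c₀ x₀ w)])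
    have h2 := nwEstimator_sub_sq_le (K := K) (σ := σ) hR x₀ w
    have h3 : 1 ≤ 4 * (degree K σ x₀ w - n * m) ^ 2 / (c₀ * n) ^ 2 := by
      rw [le_div_iff₀ (by positivity), one_mul]
      have h4 : c₀ * n / 2 ≤ n * m - degree K σ x₀ w := by linarith
      have h5 : 0 ≤ c₀ * n / 2 := by positivity
      nlinarith
    have h6 : Cbot + 4 * R ^ 2 ≤
        (Cbot + 4 * R ^ 2) * (4 * (degree K σ x₀ w - n * m) ^ 2 / (c₀ * n) ^ 2) :=
      le_mul_of_one_le_right (by positivity) h3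
    have h7 : 0 ≤ δ * Cbot := by positivity
    have h8 : 0 ≤ (∑ i, scaledKernel K σ x₀ (w i).1 * ((w i).2 - θ)) ^ 2 / (c₀ * n) ^ 2 := by
      positivity
    linarith

/-- Design points lie in `M` almost surely, so the projection acts trivially on the sample and no
measurability of `proj` is needed. -/
lemma IsProjection.apply_of_mem {d : ℕ} {M : Set (Space d)} {proj : Space d → Space d}
    (h : IsProjection M proj) {x : Space d} (hx : x ∈ M) : proj x = x := by
  have := (h x).2
  rw [Metric.infDist_zero_of_mem hx] at this
  exact (dist_eq_zero.1 this).symm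

/-- A bound on the risk from a bound on the loss given the data with clipped responses. -/
lemma risk_nwEptr_le {d s n : ℕ} {Cf Lf Lμ r₀ σe CK σ c₀ R ε δ Cbot : ℝ} {M : Set (Space d)}
    {μ f : Space d → ℝ} {x₀ : Space d} {K : ℝ → ℝ} {proj : Space d → Space d} {bot : Measure ℝ}
    [IsProbabilityMeasure bot] (h : IsRegressionModel s Cf Lf Lμ r₀ M μ f σe x₀)
    (hproj : IsProjection M proj) (hbot : ∀ᵐ t ∂bot, (t - f x₀) ^ 2 ≤ Cbot) (hCbot : 0 ≤ Cbot)
    (hδ : 0 < δ) (hδ1 : δ ≤ 1) {U : (Fin n → Space d × ℝ) → ℝ}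
    (hUi : Integrable U (sampleLaw n μ f σe))
    (hU : ∀ z, (1 - releaseProb ε δ (nwGamma K CK σ c₀ x₀ fun i => ((z i).1, clip R (z i).2))) *
        Cbot + (nwEstimator K σ R x₀ (fun i => ((z i).1, clip R (z i).2)) - f x₀) ^ 2 ≤ U z) :
    risk (sampleLaw n μ f σe) (nwEptr (n := n) proj K CK σ c₀ R ε δ bot x₀) (f x₀) ≤
      ENNReal.ofReal (∫ z, U z ∂sampleLaw n μ f σe +
        (2 * (4 * R * CK / (σ ^ d * c₀ * n)) / ε) ^ 2 * (2 * Real.log (1.25 / δ))) := by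
  have hprob := isProbabilityMeasure_obsLaw h.f_measurable h.design_prob σe
  have hprob' : IsProbabilityMeasure (sampleLaw n μ f σe) := by unfold sampleLaw; infer_instance
  have hU0 : ∀ z, 0 ≤ U z := fun z => le_trans (add_nonneg
    (mul_nonneg (one_sub_releaseProb_nonneg _ _ _) hCbot) (sq_nonneg _)) (hU z)
  set b : ℝ := (2 * (4 * R * CK / (σ ^ d * c₀ * n)) / ε) ^ 2 * (2 * Real.log (1.25 / δ)) with hb
  have hb0 : 0 ≤ b := by
    have hlog : 0 ≤ Real.log (1.25 / δ) :=
      Real.log_nonneg ((one_le_div hδ).2 (hδ1.trans (by norm_num)))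
    positivity
  have hmem : ∀ᵐ z ∂sampleLaw n μ f σe, ∀ i, (z i).1 ∈ M :=
    ae_all_iff.2 fun i => (measurePreserving_eval (fun _ => obsLaw μ f σe)
      i).quasiMeasurePreserving.ae h.ae_fst_mem
  have h1 : ∫ z, (U z + b) ∂sampleLaw n μ f σe = ∫ z, U z ∂sampleLaw n μ f σe + b := by
    rw [integral_add hUi (integrable_const _)]
    simp
  have hUb : Integrable (fun z => U z + b) (sampleLaw n μ f σe) := hUi.add (integrable_const _)
  rw [risk, ← h1, ofReal_integral_eq_lintegral_ofReal hUb
    (Filter.Eventually.of_forall fun z => add_nonneg (hU0 z) hb0)]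
  refine lintegral_mono_ae (hmem.mono fun z hz => ?_)
  have h2 : (fun i => (proj (z i).1, clip R (z i).2)) = fun i => ((z i).1, clip R (z i).2) := by
    funext i
    rw [hproj.apply_of_mem (hz i)]
  rw [nwEptr, h2]
  refine (lintegral_eptrLaw_le hbot hCbot hδ hδ1).trans (ENNReal.ofReal_le_ofReal ?_)
  linarith [hU z]

/-! ### Bandwidth arithmetic and privacy noise -/

/-- Powers of the bandwidth `σ = n ^ (-1 / (d + 2 s))`. -/
lemma bandwidth_facts {d s n : ℕ} (hs : 1 ≤ s) (hn : 2 ≤ n) {σ : ℝ}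
    (hσ : σ = (n : ℝ) ^ (-(1 : ℝ) / ((d : ℝ) + 2 * (s : ℝ)))) :
    0 < σ ∧ σ ≤ 1 ∧ 1 / n ≤ σ ^ s ∧ (σ ^ s) ^ 2 = 1 / (n * σ ^ d) ∧
      (n : ℝ) ^ (-(2 * (s : ℝ)) / (2 * (s : ℝ) + (d : ℝ))) = 1 / (n * σ ^ d) ∧
      (n : ℝ) ^ (-(4 * (s : ℝ)) / (2 * (s : ℝ) + (d : ℝ))) = (1 / (n * σ ^ d)) ^ 2 := by
  have hn0 : (0 : ℝ) < n := by positivity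
  have hn1 : (1 : ℝ) ≤ n := by exact_mod_cast (by omega : 1 ≤ n)
  have hs1 : (1 : ℝ) ≤ s := by exact_mod_cast hs
  have hd0 : (0 : ℝ) ≤ d := Nat.cast_nonneg d
  have hpow : ∀ k : ℕ, σ ^ k = (n : ℝ) ^ (-(k : ℝ) / ((d : ℝ) + 2 * (s : ℝ))) := fun k => by
    rw [hσ, ← Real.rpow_natCast, ← Real.rpow_mul hn0.le]
    congr 1
    ring
  have hS : 1 / ((n : ℝ) * σ ^ d) = (n : ℝ) ^ (-(2 * (s : ℝ)) / (2 * (s : ℝ) + (d : ℝ))) := by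
    rw [hpow, one_div, ← Real.rpow_one_add' hn0.le, ← Real.rpow_neg hn0.le]
    · congr 1
      field_simp
      ring
    · have : 1 + -(d : ℝ) / (d + 2 * s) = 2 * s / (d + 2 * s) := by field_simp; ring
      rw [this]
      positivity
  refine ⟨by rw [hσ]; positivity, ?_, ?_, ?_, hS.symm, ?_⟩
  · rw [hσ]
    exact Real.rpow_le_one_of_one_le_of_nonpos hn1
      (div_nonpos_of_nonpos_of_nonneg (by norm_num) (by positivity))
  · rw [hpow, one_div, ← Real.rpow_neg_one]
    refine Real.rpow_le_rpow_of_exponent_le hn1 ?_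
    rw [le_div_iff₀ (by positivity)]
    linarith
  · rw [hS, ← pow_mul, hpow]
    congr 1
    push_cast
    ring
  · rw [hS, ← Real.rpow_natCast, ← Real.rpow_mul hn0.le]
    congr 1
    push_cast
    ring

/-- The variance of the privacy noise. -/
lemma noise_le {d n : ℕ} {σ R c₀ CK CR ε δ : ℝ} (hn : (0 : ℝ) < n) (hσ : 0 < σ) (hc₀ : 0 < c₀)
    (hε : 0 < ε) (hδ : 0 < δ) (hδ2 : 2 ≤ 1 / δ) (hR : R ^ 2 ≤ CR ^ 2 * Real.log (1 / δ))
    (hlog : 1 ≤ Real.log (1 / δ)) :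
    (2 * (4 * R * CK / (σ ^ d * c₀ * n)) / ε) ^ 2 * (2 * Real.log (1.25 / δ)) ≤
      256 * CK ^ 2 * CR ^ 2 / c₀ ^ 2 *
        (Real.log (1 / δ) ^ 3 * (1 / ε ^ 2) * (1 / (n * σ ^ d)) ^ 2) := by
  have h0 : Real.log (1.25 / δ) ≤ 2 * Real.log (1 / δ) := by
    -- Uses `1.25 ≤ 2 ≤ 1/δ`.
    have h2 : (1.25 : ℝ) / δ ≤ (1 / δ) ^ 2 := by
      rw [sq, div_eq_mul_one_div]
      gcongr
      linarith
    have h3 := Real.log_le_log (by positivity) h2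
    rw [Real.log_pow] at h3
    exact_mod_cast h3
  have h4 : (2 * (4 * R * CK / (σ ^ d * c₀ * n)) / ε) ^ 2 =
      64 * CK ^ 2 / c₀ ^ 2 * ((1 / ε ^ 2) * (1 / (n * σ ^ d)) ^ 2) * R ^ 2 := by
    field_simp
    ring
  have h5 : Real.log (1 / δ) ^ 2 ≤ Real.log (1 / δ) ^ 3 := pow_le_pow_right₀ hlog (by norm_num)
  generalize Real.log (1 / δ) = Y at *
  rw [h4]
  calc _ ≤ 64 * CK ^ 2 / c₀ ^ 2 * ((1 / ε ^ 2) * (1 / (n * σ ^ d)) ^ 2) * (CR ^ 2 * Y) *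
        (2 * (2 * Y)) := by
        refine (mul_le_mul_of_nonneg_left (mul_le_mul_of_nonneg_left h0 zero_le_two)
          (by positivity)).trans (mul_le_mul_of_nonneg_right ?_ (by positivity))
        gcongr
    _ = 256 * CK ^ 2 * CR ^ 2 / c₀ ^ 2 * (Y ^ 2 * (1 / ε ^ 2) * (1 / (n * σ ^ d)) ^ 2) := by ring
    _ ≤ _ := by gcongr

end EPTR

/-! ### Assembly: two trivial regimes and the main one -/

theorem mainTheorem9 (d s : ℕ) (hd : 1 ≤ d) (hs : 1 ≤ s)
    (Cf Lf Lμ r₀ CK c₀ CR Cbot : ℝ) (hr₀ : 0 < r₀) (hc₀ : 0 < c₀) :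
    ∃ (C : ℝ) (k : ℕ),
      ∀ (M : Set (EPTR.Space d)) (μ f : EPTR.Space d → ℝ) (σe : ℝ) (x₀ : EPTR.Space d)
        (K : ℝ → ℝ) (proj : EPTR.Space d → EPTR.Space d) (bot : Measure ℝ)
        (n : ℕ) (σ R ε δ : ℝ),
        EPTR.IsRegressionModel s Cf Lf Lμ r₀ M μ f σe x₀ →
        EPTR.IsRegularKernel d s CK K →
        EPTR.IsProjection M proj →
        IsProbabilityMeasure bot →
        (∀ᵐ t ∂bot, (t - f x₀) ^ 2 ≤ Cbot) →
        2 ≤ n →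
        σ = (n : ℝ) ^ (-(1 : ℝ) / ((d : ℝ) + 2 * (s : ℝ))) →
        Cf * (1 + 4 * Real.sqrt (Real.log n)) ≤ R →
        R ≤ CR * Real.sqrt (Real.log n) →
        0 < ε →
        0 < δ →
        δ ≤ 1 / (n : ℝ) ^ 3 →
        2 * c₀ + 4 / ((n : ℝ) * σ ^ d) * CK < μ x₀ →
        (1 + 8 * Real.log (1 / δ)) / (μ x₀ * ε) ≤ (n : ℝ) →
        EPTR.risk (EPTR.sampleLaw n μ f σe)
            (EPTR.nwEptr (n := n) proj K CK σ c₀ R ε δ bot x₀) (f x₀) ≤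
          ENNReal.ofReal (C *
            (Real.log n ^ k *
                (n : ℝ) ^ (-(2 * (s : ℝ)) / (2 * (s : ℝ) + (d : ℝ))) +
              Real.log (1 / δ) ^ k * (1 / ε ^ 2) *
                (n : ℝ) ^ (-(4 * (s : ℝ)) / (2 * (s : ℝ) + (d : ℝ))))) := by
  rcases le_or_gt CK 0 with hCK | hCK
  -- For `CK ≤ 0` the decay bound forces `K = 0`, against its unit integral.
  · exact ⟨0, 0, fun M μ f σe x₀ K proj bot n σ R ε δ _ hK => absurd hK.const_pos hCK.not_gt⟩
  obtain ⟨CD, hCD, HD⟩ := EPTR.exists_degree_moment hd hs Cf Lf Lμ hr₀ hCK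
  obtain ⟨CN, hCN, HN⟩ := EPTR.exists_numerator_moment hd hs Cf Lf Lμ hr₀ hCK
  -- In the main regime `ε S ≥ A log(1/δ)`. The part `1` of `A` yields `1/ε ≤ S ≤ n ≤ 1/δ`, so `1/δ`
  -- is the maximum in the threshold; the part `32 CK / c₀` makes `ε γ` large enough for release.
  obtain ⟨A, hA⟩ : ∃ A : ℝ, A = max 1 (32 * CK / c₀) := ⟨_, rfl⟩
  obtain ⟨B, hB⟩ : ∃ B : ℝ, B = |Cbot| + 4 * CR ^ 2 := ⟨_, rfl⟩
  have hA1 : 1 ≤ A := hA ▸ le_max_left _ _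
  have hB0 : 0 ≤ B := by rw [hB]; positivity
  obtain ⟨c1, hc1⟩ : ∃ c : ℝ, c = 256 * CK ^ 2 * CR ^ 2 / c₀ ^ 2 := ⟨_, rfl⟩
  obtain ⟨c2, hc2⟩ : ∃ c : ℝ, c = B * A ^ 2 := ⟨_, rfl⟩
  obtain ⟨c3, hc3⟩ : ∃ c : ℝ, c = 8 * B * (8 * CK / c₀) := ⟨_, rfl⟩
  obtain ⟨c4, hc4⟩ : ∃ c : ℝ, c = 8 * (|Cbot| + CN / c₀ ^ 2 * (CR ^ 2 + 1) +
    B * (8 * CD / c₀ ^ 2)) := ⟨_, rfl⟩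
  have hc1' : 0 ≤ c1 := by rw [hc1]; positivity
  have hc2' : 0 ≤ c2 := by rw [hc2]; positivity
  have hc3' : 0 ≤ c3 := by rw [hc3]; positivity
  have hc4' : 0 ≤ c4 := by rw [hc4]; positivity
  refine ⟨c1 + c2 + c3 + c4, 3, ?_⟩
  intro M μ f σe x₀ K proj bot n σ R ε δ h hK hproj hbp hbot hn hσdef hR hR' hε hδ hδn hμ _
  obtain ⟨hσ, hσ1, hnσ, hσs, hr1, hr2⟩ := EPTR.bandwidth_facts (d := d) hs hn hσdef
  rw [hr1, hr2]
  have hn0 : (0 : ℝ) < n := by positivity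
  have hn2 : (2 : ℝ) ≤ n := by exact_mod_cast hn
  set S : ℝ := n * σ ^ d with hS
  have hS0 : 0 < S := by positivity
  have hSn : S ≤ n := mul_le_of_le_one_right hn0.le (pow_le_one₀ hσ.le hσ1)
  set X : ℝ := Real.log n with hX
  set Y : ℝ := Real.log (1 / δ) with hY
  have hX1 : 1 / 2 ≤ X := by
    have := Real.log_le_log (by norm_num) hn2
    linarith [Real.log_two_gt_d9]
  have hδn' : (n : ℝ) ^ 3 ≤ 1 / δ := by
    rw [le_div_iff₀ hδ]
    rw [le_div_iff₀ (by positivity)] at hδn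
    linarith
  have hXY : 3 * X ≤ Y := by
    have := Real.log_le_log (by positivity) hδn'
    rw [Real.log_pow] at this
    exact_mod_cast this
  have hY1 : 1 ≤ Y := by linarith
  have hδ1 : δ ≤ 1 := hδn.trans ((div_le_one (by positivity)).2 (one_le_pow₀ (by linarith)))
  have hinvδ : (n : ℝ) ≤ 1 / δ := (le_self_pow₀ (by linarith) (by norm_num)).trans hδn'
  have hCf := h.noise_const_nonneg
  have hf0 : |f x₀| ≤ Cf := h.f_bound x₀ (h.interior (Metric.mem_ball_self hr₀))
  have hfR : |f x₀| ≤ R :=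
    hf0.trans ((le_mul_of_one_le_right hCf (by linarith [Real.sqrt_nonneg X])).trans hR)
  have hR0 : 0 ≤ R := (abs_nonneg _).trans hfR
  have hR2 : R ^ 2 ≤ CR ^ 2 * X := by
    calc R ^ 2 ≤ (CR * Real.sqrt X) ^ 2 := pow_le_pow_left₀ hR0 hR' 2
      _ = _ := by rw [mul_pow, Real.sq_sqrt (by linarith)]
  have hbot' : ∀ᵐ t ∂bot, (t - f x₀) ^ 2 ≤ |Cbot| := hbot.mono fun t ht => ht.trans (le_abs_self _)
  -- `log n` is below `1` when `n = 2`, so passing to its cube costs a factor `8`, from `log n ≥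
  -- 1/2`.
  have hX3 : 1 ≤ 8 * X ^ 3 := by
    have := pow_le_pow_left₀ (by norm_num) hX1 3
    linarith
  have hXX : X ≤ 8 * X ^ 3 := by
    have h1 := pow_le_pow_left₀ (by norm_num) hX1 2
    have h2 : X ≤ X * (8 * X ^ 2) := le_mul_of_one_le_right (by linarith) (by linarith)
    linarith
  set V : ℝ := X ^ 3 * (1 / S) with hV
  set W : ℝ := Y ^ 3 * (1 / ε ^ 2) * (1 / S) ^ 2 with hW
  have hV0 : 0 ≤ V := by rw [hV]; positivity
  have hW0 : 0 ≤ W := by rw [hW]; positivity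
  clear_value V W
  have hnoise : (2 * (4 * R * CK / (σ ^ d * c₀ * n)) / ε) ^ 2 * (2 * Real.log (1.25 / δ)) ≤
      c1 * W := by
    rw [hc1, hW, hS, hY]
    exact EPTR.noise_le hn0 hσ hc₀ hε hδ (by linarith) (hR2.trans (by gcongr; linarith)) hY1
  have hsplit : (c1 + c2 + c3 + c4) * (V + W) =
      (c1 * W + c2 * W + c3 * V + c4 * V) + (c1 * V + c2 * V + c3 * W + c4 * W) := by ring
  have hrest : 0 ≤ c1 * V + c2 * V + c3 * W + c4 * W := by positivity
  have hc2W : 0 ≤ c2 * W := by positivity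
  have hc3V : 0 ≤ c3 * V := by positivity
  have hc4V : 0 ≤ c4 * V := by positivity
  have hprob := EPTR.isProbabilityMeasure_obsLaw h.f_measurable h.design_prob σe
  have hprob' : IsProbabilityMeasure (EPTR.sampleLaw n μ f σe) := by
    unfold EPTR.sampleLaw; infer_instance
  -- the loss is at most logarithmic
  have htriv : |Cbot| + 4 * R ^ 2 ≤ c2 * W + c3 * V →
      EPTR.risk (EPTR.sampleLaw n μ f σe)
          (EPTR.nwEptr (n := n) proj K CK σ c₀ R ε δ bot x₀) (f x₀) ≤
        ENNReal.ofReal ((c1 + c2 + c3 + c4) * (V + W)) := fun hle => by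
    refine (EPTR.risk_nwEptr_le h hproj hbot' (abs_nonneg _) hδ hδ1
      (U := fun _ => |Cbot| + 4 * R ^ 2) (integrable_const _) fun z => ?_).trans
      (ENNReal.ofReal_le_ofReal ?_)
    · refine add_le_add (mul_le_of_le_one_left (abs_nonneg _) ?_)
        (EPTR.nwEstimator_sub_sq_le hfR x₀ _)
      linarith [EPTR.releaseProb_nonneg ε δ
        (EPTR.nwGamma K CK σ c₀ x₀ fun i => ((z i).1, EPTR.clip R (z i).2))]
    · simp only [integral_const, probReal_univ, smul_eq_mul, one_mul]
      linarith
  -- For small `S` the rate `1/S` is bounded below, so the statistical term dominates the trivial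
  -- loss.
  rcases lt_or_ge (S * c₀) (8 * CK) with hcase | hcase
  · refine htriv (le_trans ?_ (le_add_of_nonneg_left hc2W))
    have h1 : 1 ≤ 8 * CK / c₀ * (1 / S) := by
      rw [div_mul_div_comm, mul_one, one_le_div (by positivity)]
      linarith
    calc |Cbot| + 4 * R ^ 2 ≤ |Cbot| * (8 * X ^ 3) + 4 * (CR ^ 2 * (8 * X ^ 3)) :=
          add_le_add (le_mul_of_one_le_right (abs_nonneg _) hX3)
            (mul_le_mul_of_nonneg_left (hR2.trans (by gcongr)) (by norm_num))
      _ = 8 * B * X ^ 3 := by rw [hB]; ring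
      _ ≤ 8 * B * X ^ 3 * (8 * CK / c₀ * (1 / S)) := le_mul_of_one_le_right (by positivity) h1
      _ = c3 * V := by rw [hc3, hV]; ring
  -- For small `ε S` the privacy term satisfies `W = Y^3/(εS)^2 ≥ Y/A^2`, which dominates the
  -- trivial loss of order `Y`. This is where the power `k = 3` is used up.
  rcases lt_or_ge (ε * S) (A * Y) with hcase2 | hcase2
  · refine htriv (le_trans ?_ (le_add_of_nonneg_right hc3V))
    have h1 : 1 ≤ A ^ 2 * Y ^ 2 * ((1 / ε ^ 2) * (1 / S) ^ 2) := by
      have h2 : (ε * S) ^ 2 ≤ (A * Y) ^ 2 := pow_le_pow_left₀ (by positivity) hcase2.le 2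
      rw [one_div_pow, div_mul_div_comm, mul_one, mul_one_div, one_le_div (by positivity)]
      linarith [mul_pow ε S 2, mul_pow A Y 2]
    calc |Cbot| + 4 * R ^ 2 ≤ |Cbot| * Y + 4 * (CR ^ 2 * Y) :=
          add_le_add (le_mul_of_one_le_right (abs_nonneg _) hY1)
            (mul_le_mul_of_nonneg_left (hR2.trans (by gcongr; linarith)) (by norm_num))
      _ = B * Y := by rw [hB]; ring
      _ ≤ B * Y * (A ^ 2 * Y ^ 2 * ((1 / ε ^ 2) * (1 / S) ^ 2)) :=
          le_mul_of_one_le_right (by positivity) h1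
      _ = c2 * W := by rw [hc2, hW]; ring
  -- the regime in which the test is passed
  have hmax : 1 / ε ≤ 1 / δ := by
    refine le_trans ?_ (hSn.trans hinvδ)
    rw [div_le_iff₀ hε]
    exact (one_le_mul_of_one_le_of_one_le hA1 hY1).trans (hcase2.trans_eq (mul_comm _ _))
  have hSε : 32 * CK * Y ≤ ε * (S * c₀) := by
    have h1 : 32 * CK / c₀ * Y ≤ ε * S :=
      (mul_le_mul_of_nonneg_right (hA ▸ le_max_right _ _) (by linarith)).trans hcase2
    have h2 := mul_le_mul_of_nonneg_right h1 hc₀.le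
    have h3 : 32 * CK / c₀ * Y * c₀ = 32 * CK * Y := by field_simp
    linarith
  obtain ⟨hDi, hDb⟩ := HD M μ f σe x₀ K σ n h hK hσ hσ1
  obtain ⟨hNi, hNb⟩ := HN M μ f σe x₀ K σ R n h hK hσ hσ1 hn hnσ hR
  have hsq : ((n : ℝ) * σ ^ s) ^ 2 = n ^ 2 * (1 / S) := by rw [mul_pow, hσs]
  have hnd : (n : ℝ) * (1 / σ ^ d) = n ^ 2 * (1 / S) := by rw [hS]; field_simp
  rw [hsq, hnd] at hDb hNb
  have hint1 : Integrable (fun z : Fin n → EPTR.Space d × ℝ => δ * |Cbot| +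
      (∑ i, EPTR.scaledKernel K σ x₀ (z i).1 * (EPTR.clip R (z i).2 - f x₀)) ^ 2 / (c₀ * n) ^ 2)
      (EPTR.sampleLaw n μ f σe) := (integrable_const _).add (hNi.div_const _)
  have hint2 : Integrable (fun z : Fin n → EPTR.Space d × ℝ => (|Cbot| + 4 * R ^ 2) *
      (4 * (EPTR.degree K σ x₀ z - n * μ x₀) ^ 2 / (c₀ * n) ^ 2)) (EPTR.sampleLaw n μ f σe) :=
    ((hDi.const_mul 4).div_const _).const_mul _
  refine (EPTR.risk_nwEptr_le h hproj hbot' (abs_nonneg _) hδ hδ1 (hint1.add hint2)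
    fun z => EPTR.loss_le hCK hσ (by omega) hc₀ hμ hfR hε hδ hmax (abs_nonneg _) hcase hSε x₀
      fun i => ((z i).1, EPTR.clip R (z i).2)).trans (ENNReal.ofReal_le_ofReal ?_)
  have hmain : ∫ z, (δ * |Cbot| +
      (∑ i, EPTR.scaledKernel K σ x₀ (z i).1 * (EPTR.clip R (z i).2 - f x₀)) ^ 2 / (c₀ * n) ^ 2 +
      (|Cbot| + 4 * R ^ 2) * (4 * (EPTR.degree K σ x₀ z - n * μ x₀) ^ 2 / (c₀ * n) ^ 2))
      ∂EPTR.sampleLaw n μ f σe ≤ c4 * V := by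
    rw [integral_add hint1 hint2, integral_add (integrable_const _) (hNi.div_const _)]
    simp only [integral_const_mul, integral_div, integral_const, probReal_univ, smul_eq_mul, one_mul]
    have e1 : δ ≤ 1 / S := by
      rw [le_one_div hδ hS0]
      exact hSn.trans hinvδ
    have e2 : |Cbot| + 4 * R ^ 2 ≤ 8 * X ^ 3 * B := by
      calc |Cbot| + 4 * R ^ 2 ≤ |Cbot| * (8 * X ^ 3) + 4 * (CR ^ 2 * (8 * X ^ 3)) :=
            add_le_add (le_mul_of_one_le_right (abs_nonneg _) hX3)
              (mul_le_mul_of_nonneg_left (hR2.trans (by gcongr)) (by norm_num))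
        _ = _ := by rw [hB]; ring
    have e3 : R ^ 2 * (n ^ 2 * (1 / S)) + n ^ 2 * (1 / S) ≤
        8 * X ^ 3 * ((CR ^ 2 + 1) * (n ^ 2 * (1 / S))) := by
      calc _ = (R ^ 2 + 1) * (n ^ 2 * (1 / S)) := by ring
        _ ≤ (CR ^ 2 * (8 * X ^ 3) + 8 * X ^ 3) * (n ^ 2 * (1 / S)) := by
            have : R ^ 2 ≤ CR ^ 2 * (8 * X ^ 3) := hR2.trans (by gcongr)
            gcongr
        _ = _ := by ring
    calc _ ≤ 1 / S * (|Cbot| * (8 * X ^ 3)) +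
          CN * (8 * X ^ 3 * ((CR ^ 2 + 1) * (n ^ 2 * (1 / S)))) / (c₀ * n) ^ 2 +
          8 * X ^ 3 * B * (4 * (CD * (n ^ 2 * (1 / S) + n ^ 2 * (1 / S))) / (c₀ * n) ^ 2) := by
          gcongr
          · exact le_mul_of_one_le_right (abs_nonneg _) hX3
          · exact hNb.trans (by gcongr)
      _ = c4 * V := by
          rw [hc4, hV]
          field_simp
          ring
  have hle := add_le_add hmain hnoise
  refine hle.trans ?_
  linarith
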